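/- Let $K$ be an abelian number field of conductor $n$, i.e. $K/\mathbb{Q}$ is a finite abelian extension and $n$ is the least positive integer such that $K$ embeds in the $n$-th cyclotomic field. Fix an embedding of $K$ in $\mathbb{Q}^{(n)}=\mathbb{Q}(\zeta_n)$, where $\zeta_n$ is a primitive $n$-th root of unity, and let $T=T_{\mathbb{Q}^{(n)}/K}$ be the trace. Write $n=2^e m$ with $m$ odd, and let $\zeta_{2^e},\zeta_m\in\mathbb{Q}^{(n)}$ be any primitive roots of unity of orders $2^e$ and $m$. The adjusted trace map is the $\mathbb{Q}$-linear map $\hat T=\hat T_{\mathbb{Q}^{(n)}/K}:\mathbb{Q}^{(n)}\to K$ defined as follows. If $\mathbb{Q}^{(n)}/K$ is (at most) tamely ramified at every prime, then $\hat T=T$. Otherwise (in which case $e\ge 3$), $\hat T$ is given on the $\mathbb{Q}$-basis $\{\zeta_{2^e}^i\zeta_m^j : 0\le i\le 2^{e-1}-1,\ 0\le j\le \varphi(m)-1\}$ of $\mathbb{Q}^{(n)}$ by $$\hat T(\zeta_{2^e}^i\zeta_m^j)=\begin{cases}\tfrac12\,T(\zeta_m^j) & \text{if } i=0,\\ T(\zeta_{2^e}^i\zeta_m^j)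 & \text{if } 1\le i\le 2^{e-1}-1.\end{cases}$$ Let $r(n)=\prod_{p\mid n}p$ be the product of the distinct primes dividing $n$, let $\mathcal{D}(n)=\{d\in\mathbb{N} : r(n)\mid d \text{ and } d\mid n\}$, and set $$\alpha=\hat T_{\mathbb{Q}^{(n)}/K}\Big(\sum_{d\in\mathcal{D}(n)}\zeta_n^{\,n/d}\Big).$$ Let $\mathcal{O}_K$ be the ring of integers of $K$ and let $\mathcal{A}_{K/\mathbb{Q}}=\{\gamma\in\mathbb{Q}[\mathrm{Gal}(K/\mathbb{Q})] : \gamma(\mathcal{O}_K)\subseteq\mathcal{O}_K\}$ be the associated order of $K/\mathbb{Q}$. Then $\mathcal{O}_K=\mathcal{A}_{K/\mathbb{Q}}\cdot\alpha$, and so $\mathcal{O}_K$ is a free $\mathcal{A}_{K/\mathbb{Q}}$-module of rank $1$. -/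

import Mathlib

open scoped NumberField

noncomputable section

namespace Leopoldt

/-! ### Conductor and tame ramification -/

/-- `n` is the conductor of the abelian number field `K`: the least positive integer such that
`K` can be embedded in the `n`-th cyclotomic field. -/
def IsConductor (K : Type*) [Field K] [NumberField K] (n : ℕ) : Prop :=
  IsLeast {m : ℕ | 0 < m ∧ Nonempty (K →ₐ[ℚ] CyclotomicField m ℚ)} n

/-- An extension `L / K` of number fields is (at most) tamely ramified: the ramification index over
`K` of every nonzero prime ideal `P` of the ring of integers of `L` is prime to the residue
characteristic of `P`, that is, to the rational prime lying in `P`. (Residue fields are finite, so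
residue field extensions are separable.) -/
def IsTame (K L : Type*) [Field K] [NumberField K] [Field L] [NumberField L] [Algebra K L] : Prop :=
  ∀ P : Ideal (𝓞 L), P.IsPrime → P ≠ ⊥ →
    ∀ p : ℕ, p.Prime → (p : 𝓞 L) ∈ P → ¬ p ∣ P.ramificationIdx (𝓞 K)

/-! ### The associated order -/

section AssociatedOrder

variable (K L : Type*) [Field K] [Field L] [Algebra K L]

/-- The action of the group algebra `K[Gal(L/K)]` on `L`, extending that of the Galois group
`K`-linearly. -/
def groupAlgebraAction : MonoidAlgebra K Gal(L/K) →ₐ[K] Module.End K L :=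
  MonoidAlgebra.lift K (Module.End K L) Gal(L/K) (AlgEquiv.toLinearMapHom K L)

theorem groupAlgebraAction_single (σ : Gal(L/K)) (c : K) (x : L) :
    groupAlgebraAction K L (MonoidAlgebra.single σ c) x = c • σ x := by
  simp [groupAlgebraAction]

/-- The associated order `{γ ∈ K[Gal(L/K)] | γ (𝓞 L) ⊆ 𝓞 L}`. -/
def associatedOrder : Subring (MonoidAlgebra K Gal(L/K)) where
  carrier := {γ | ∀ x : L, IsIntegral ℤ x → IsIntegral ℤ (groupAlgebraAction K L γ x)}
  mul_mem' {a b} ha hb x hx := by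
    rw [map_mul, Module.End.mul_apply]
    exact ha _ (hb x hx)
  one_mem' x hx := by simpa using hx
  add_mem' {a b} ha hb x hx := by
    rw [map_add, LinearMap.add_apply]
    exact (ha x hx).add (hb x hx)
  zero_mem' x _ := by simpa using isIntegral_zero
  neg_mem' {a} ha x hx := by
    rw [map_neg, LinearMap.neg_apply]
    exact (ha x hx).neg

/-- The ring of integers of `L` as a module over the associated order of `L / K`. -/
instance moduleAssociatedOrder : Module (associatedOrder K L) (𝓞 L) where
  smul γ x := ⟨groupAlgebraAction K L γ.1 (x : L), γ.2 _ x.2⟩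
  one_smul x := by
    apply NumberField.RingOfIntegers.ext
    change groupAlgebraAction K L 1 (x : L) = x
    simp
  mul_smul a b x := by
    apply NumberField.RingOfIntegers.ext
    change groupAlgebraAction K L (a.1 * b.1) (x : L) = _
    rw [map_mul]
    rfl
  smul_zero a := by
    apply NumberField.RingOfIntegers.ext
    exact map_zero (groupAlgebraAction K L a.1)
  smul_add a x y := by
    apply NumberField.RingOfIntegers.ext
    exact map_add (groupAlgebraAction K L a.1) (x : L) y
  add_smul a b x := by
    apply NumberField.RingOfIntegers.ext
    change groupAlgebraAction K L (a.1 + b.1) (x : L) = _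
    rw [map_add]
    rfl
  zero_smul x := by
    apply NumberField.RingOfIntegers.ext
    change groupAlgebraAction K L 0 (x : L) = 0
    simp

theorem coe_smul (γ : associatedOrder K L) (x : 𝓞 L) :
    ((γ • x : 𝓞 L) : L) = groupAlgebraAction K L γ x := rfl

end AssociatedOrder

/-! ### The adjusted trace map -/

/-- The exponent `v₂(n)` of `2` in `n`. -/
abbrev twoExp (n : ℕ) : ℕ := n.factorization 2

/-- The odd part `n / 2 ^ v₂(n)` of `n`. -/
abbrev oddPart (n : ℕ) : ℕ := n / 2 ^ twoExp n

section Basis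

variable {L : Type*} [Field L] [NumberField L] {n : ℕ} [NeZero n] [IsCyclotomicExtension {n} ℚ L]
  {ζ₂ ζₘ : L}

theorem coprime_oddPart (n : ℕ) [NeZero n] : (2 ^ twoExp n).Coprime (oddPart n) :=
  (Nat.coprime_ordCompl Nat.prime_two (NeZero.ne n)).pow_left _

theorem two_pow_mul_oddPart (n : ℕ) : 2 ^ twoExp n * oddPart n = n :=
  Nat.ordProj_mul_ordCompl_eq_self n 2

theorem oddPart_pos (n : ℕ) [NeZero n] : 0 < oddPart n := Nat.ordCompl_pos 2 (NeZero.ne n)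

theorem totient_two_pow (e : ℕ) : (2 ^ e).totient = 2 ^ (e - 1) := by
  rcases Nat.eq_zero_or_pos e with rfl | he
  · simp
  · simp [Nat.totient_prime_pow Nat.prime_two he]

theorem adjoin_le_span {k : ℕ} (hk : 0 < k) {ζ : L} (hζ : IsPrimitiveRoot ζ k) :
    Subalgebra.toSubmodule (Algebra.adjoin ℚ {ζ}) ≤
      Submodule.span ℚ (Set.range fun i : Fin k.totient => ζ ^ (i : ℕ)) := by
  have h0 : Polynomial.aeval ζ (Polynomial.cyclotomic k ℚ) = 0 := by
    rw [Polynomial.aeval_def, Polynomial.eval₂_eq_eval_map, Polynomial.map_cyclotomic]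
    exact hζ.isRoot_cyclotomic hk
  rw [← Submodule.span_range_natDegree_eq_adjoin (Polynomial.cyclotomic.monic k ℚ) h0,
    Polynomial.natDegree_cyclotomic]
  apply Submodule.span_mono
  intro x hx
  simp only [Finset.coe_image, Finset.coe_range, Set.mem_image, Set.mem_Iio] at hx
  obtain ⟨i, hi, rfl⟩ := hx
  exact ⟨⟨i, hi⟩, rfl⟩

theorem top_le_span (h₂ : IsPrimitiveRoot ζ₂ (2 ^ twoExp n))
    (hₘ : IsPrimitiveRoot ζₘ (oddPart n)) : (⊤ : Submodule ℚ L) ≤ Submodule.span ℚ (Set.range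
    fun k : Fin (2 ^ (twoExp n - 1)) × Fin (oddPart n).totient =>
      ζ₂ ^ (k.1 : ℕ) * ζₘ ^ (k.2 : ℕ)) := by
  have hζ : IsPrimitiveRoot (ζ₂ * ζₘ) n := by
    rw [IsPrimitiveRoot.iff_orderOf,
      (Commute.all ζ₂ ζₘ).orderOf_mul_eq_mul_orderOf_of_coprime, ← h₂.eq_orderOf,
      ← hₘ.eq_orderOf, two_pow_mul_oddPart]
    rw [← h₂.eq_orderOf, ← hₘ.eq_orderOf]
    exact coprime_oddPart n
  have htop : Algebra.adjoin ℚ ({ζ₂} ∪ {ζₘ} : Set L) = ⊤ := by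
    rw [eq_top_iff, ← IsCyclotomicExtension.adjoin_primitive_root_eq_top (A := ℚ) hζ]
    apply Algebra.adjoin_le
    rintro x rfl
    exact mul_mem (Algebra.subset_adjoin (by simp)) (Algebra.subset_adjoin (by simp))
  rw [← Algebra.top_toSubmodule, ← htop, Algebra.adjoin_union_coe_submodule]
  refine (mul_le_mul' (adjoin_le_span (by positivity) h₂)
    (adjoin_le_span (oddPart_pos n) hₘ)).trans ?_
  rw [Submodule.span_mul_span]
  apply Submodule.span_mono
  rintro _ ⟨_, ⟨i, rfl⟩, _, ⟨j, rfl⟩, rfl⟩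
  exact ⟨(Fin.cast (totient_two_pow _) i, j), rfl⟩

variable (h₂ : IsPrimitiveRoot ζ₂ (2 ^ twoExp n)) (hₘ : IsPrimitiveRoot ζₘ (oddPart n))

/-- The `ℚ`-basis `ζ₂ ^ i * ζₘ ^ j`, for `0 ≤ i < 2 ^ (v₂(n) - 1)` and `0 ≤ j < φ(m)`, of the
`n`-th cyclotomic field `L`, where `m` is the odd part of `n` and `ζ₂`, `ζₘ` are primitive roots of
unity of orders `2 ^ v₂(n)` and `m`. (If `n` is odd, only `i = 0` occurs.) -/
def cyclotomicBasis :
    Module.Basis (Fin (2 ^ (twoExp n - 1)) × Fin (oddPart n).totient) ℚ L :=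
  basisOfTopLeSpanOfCardEqFinrank (fun k => ζ₂ ^ (k.1 : ℕ) * ζₘ ^ (k.2 : ℕ)) (top_le_span h₂ hₘ) (by
    rw [IsCyclotomicExtension.finrank (n := n) L
      (Polynomial.cyclotomic.irreducible_rat (NeZero.pos n))]
    conv_rhs => rw [← two_pow_mul_oddPart n, Nat.totient_mul (coprime_oddPart n)]
    simp [totient_two_pow])

theorem cyclotomicBasis_apply (k : Fin (2 ^ (twoExp n - 1)) × Fin (oddPart n).totient) :
    cyclotomicBasis h₂ hₘ k = ζ₂ ^ (k.1 : ℕ) * ζₘ ^ (k.2 : ℕ) := by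
  simp [cyclotomicBasis]

variable (K : Type*) [Field K] [NumberField K] [Algebra K L]

open Classical in
/-- The adjusted trace map from the `n`-th cyclotomic field `L` to a subfield `K` of conductor `n`.
If `L / K` is tamely ramified it is the trace. Otherwise it is the `ℚ`-linear map whose values on
the basis `ζ₂ ^ i * ζₘ ^ j` are those of the trace for `i ≠ 0`, and half of those for `i = 0`. -/
def adjustedTrace : L →ₗ[ℚ] K :=
  if IsTame K L then (Algebra.trace K L).restrictScalars ℚ
  else (cyclotomicBasis h₂ hₘ).constr ℚ fun k =>
    if (k.1 : ℕ) = 0 then (1 / 2 : ℚ) • Algebra.trace K L (ζₘ ^ (k.2 : ℕ))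
    else Algebra.trace K L (ζ₂ ^ (k.1 : ℕ) * ζₘ ^ (k.2 : ℕ))

end Basis

/-! ### The generator -/

/-- The product of the distinct prime divisors of `n`. -/
def rad (n : ℕ) : ℕ := ∏ p ∈ n.primeFactors, p

/-- The set of positive integers `d` with `rad n ∣ d` and `d ∣ n` (for `n ≠ 0`). -/
def divisorSet (n : ℕ) : Finset ℕ := n.divisors.filter (rad n ∣ ·)

end Leopoldt

end

/-! The proof settles `L = ℚ(ζ_n)` first and then descends to `K`.

In `L`, let `β = ∑ ζ ^ (n / d)` over `d ∈ divisorSet n`. The relation `1 + η + ... + η ^ (p - 1) =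
0` shows that the roots of unity with order in `divisorSet n` span `ℤ[ζ] = 𝓞 L`. For such `d` the
normalized trace to `ℚ(ζ_d)` fixes or kills each of them, so it lies in the associated order. These
projections separate the summands of `β`, whose Galois conjugates are all the spanning roots; hence
`β` generates (`exists_groupAlgebraAction_sum_eq`).

For descent, it is enough that the map `F : L → K` is equivariant and sends `𝓞 L` onto `𝓞 K`; then
`F β` generates `𝓞 K` (`IsEquivariant.setOf_isIntegral_eq`). Freeness follows by comparing
dimensions over `ℚ`.

In the tame case `F` is the trace. If its image lay in a prime below `P`, the characters `x ↦ σ x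
mod P` would sum to zero, and Dedekind independence would force `p` to divide the order of the
inertia group.

In the wild case, minimality of the conductor leaves only `p = 2`, and the automorphisms over `K`
fixing `ζₘ` are `1` and an involution `τ` with `τ ζ₂ = ± ζ₂⁻¹`
(`IsConductor.exists_isWildInvolution`). Hence the traces of the powers of `ζₘ` are divisible by
`2`, which is what the adjusted trace corrects. Independence of characters again shows that every `2
z` with `z ∈ 𝓞 K` is the trace of a `τ`-fixed integer (`halfTraceIdeal_eq_top`). Keeping half of the
basis of that integer gives a preimage of `z` under the adjusted trace. -/

noncomputable section

namespace Leopoldt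

/-! ### Descent of a generator along an equivariant map -/

section Descent

variable {K L : Type*} [Field K] [NumberField K] [Field L] [NumberField L] [Algebra K L]
  [IsGalois ℚ K]

/-- A `ℚ`-linear map `L → K` compatible with the actions of `Gal(L/ℚ)` on `L` and `K`. -/
def IsEquivariant (F : L →ₗ[ℚ] K) : Prop :=
  ∀ (σ : Gal(L/ℚ)) (x : L), F (σ x) = AlgEquiv.restrictNormal σ K (F x)

/-- The element `γ'` is the image of `γ` under restriction of automorphisms to `K`. -/
theorem IsEquivariant.exists_groupAlgebraAction_apply {F : L →ₗ[ℚ] K} (hF : IsEquivariant F)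
    (γ : MonoidAlgebra ℚ Gal(L/ℚ)) : ∃ γ' : MonoidAlgebra ℚ Gal(K/ℚ), ∀ y,
      groupAlgebraAction ℚ K γ' (F y) = F (groupAlgebraAction ℚ L γ y) := by
  induction γ using MonoidAlgebra.induction_linear with
  | zero => exact ⟨0, fun y => by simp⟩
  | add a b ha hb =>
    obtain ⟨a', ha⟩ := ha
    obtain ⟨b', hb⟩ := hb
    exact ⟨a' + b', fun y => by simp [ha, hb]⟩
  | single σ c =>
    exact ⟨MonoidAlgebra.single (AlgEquiv.restrictNormal σ K) c, fun y => by
      rw [groupAlgebraAction_single, groupAlgebraAction_single, map_smul, hF]⟩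

/-- If `β` generates the ring of integers of `L` over the associated order of `L/ℚ`, then its image
under an equivariant map that sends the integers of `L` onto those of `K` generates the integers of
`K` over the associated order of `K/ℚ`. -/
theorem IsEquivariant.setOf_isIntegral_eq {F : L →ₗ[ℚ] K} (hF : IsEquivariant F)
    (hint : ∀ y : L, IsIntegral ℤ y → IsIntegral ℤ (F y))
    (hsurj : ∀ z : K, IsIntegral ℤ z → ∃ y : L, IsIntegral ℤ y ∧ F y = z)
    {β : L} (hβ : IsIntegral ℤ β) (hgen : ∀ y : L, IsIntegral ℤ y →
      ∃ γ ∈ associatedOrder ℚ L, groupAlgebraAction ℚ L γ β = y) :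
    {x : K | IsIntegral ℤ x} =
      {x : K | ∃ γ ∈ associatedOrder ℚ K, groupAlgebraAction ℚ K γ (F β) = x} := by
  ext x
  refine ⟨fun hx => ?_, ?_⟩
  · obtain ⟨y, hy, rfl⟩ := hsurj x hx
    obtain ⟨γ, hγ, rfl⟩ := hgen y hy
    obtain ⟨γ', hγ'⟩ := hF.exists_groupAlgebraAction_apply γ
    -- Surjectivity on integers puts `γ'` in the associated order: an integer `z = F w` is sent to
    -- `F (γ w)`.
    refine ⟨γ', fun z hz => ?_, hγ' β⟩
    obtain ⟨w, hw, rfl⟩ := hsurj z hz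
    rw [hγ']
    exact hint _ (hγ w hw)
  · rintro ⟨γ, hγ, rfl⟩
    exact hγ _ (hint β hβ)

end Descent

/-! ### Freeness from the existence of a generator -/

section Free

variable {K : Type*} [Field K] [NumberField K] [IsAbelianGalois ℚ K]

theorem _root_.MonoidAlgebra.mul_comm_of_isMulCommutative {R G : Type*} [CommSemiring R] [Monoid G]
    [IsMulCommutative G] (a b : MonoidAlgebra R G) : a * b = b * a := by
  induction a using MonoidAlgebra.induction_linear with
  | zero => simp
  | add x y hx hy => rw [add_mul, mul_add, hx, hy]
  | single g r =>
    induction b using MonoidAlgebra.induction_linear with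
    | zero => simp
    | add x y hx hy => rw [add_mul, mul_add, hx, hy]
    | single h s =>
      rw [MonoidAlgebra.single_mul_single, MonoidAlgebra.single_mul_single, mul_comm r,
        IsMulCommutative.is_comm.comm g h]

/-- Every element of `K` has a nonzero integral multiple, so `γ ↦ γ α` maps the group algebra onto
`K`. Both sides have dimension `[K : ℚ]`. -/
theorem groupAlgebraAction_apply_injective {α : K}
    (hα : ∀ x : K, IsIntegral ℤ x →
      ∃ γ ∈ associatedOrder ℚ K, groupAlgebraAction ℚ K γ α = x) :
    Function.Injective fun γ : MonoidAlgebra ℚ Gal(K/ℚ) => groupAlgebraAction ℚ K γ α := by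
  let Φ : MonoidAlgebra ℚ Gal(K/ℚ) →ₗ[ℚ] K :=
    (LinearMap.applyₗ α).comp (groupAlgebraAction ℚ K).toLinearMap
  have hsurj : Function.Surjective Φ := fun x => by
    obtain ⟨d, hd, hx⟩ := IsAlgebraic.exists_integral_multiple
      ((IsFractionRing.isAlgebraic_iff ℤ ℚ K).2 (Algebra.IsAlgebraic.isAlgebraic (R := ℚ) x))
    obtain ⟨γ, -, hγ⟩ := hα _ hx
    refine ⟨(d : ℚ)⁻¹ • γ, ?_⟩
    have : Φ γ = d • x := hγ
    rw [map_smul, this, ← Int.cast_smul_eq_zsmul ℚ, inv_smul_smul₀ (by exact_mod_cast hd)]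
  let e := MonoidAlgebra.coeffLinearEquiv (M := Gal(K/ℚ)) (S := ℚ) ℚ
  have : FiniteDimensional ℚ (MonoidAlgebra ℚ Gal(K/ℚ)) := Module.Finite.equiv e.symm
  have hfin : Module.finrank ℚ (MonoidAlgebra ℚ Gal(K/ℚ)) = Module.finrank ℚ K := by
    rw [← IsGalois.card_aut_eq_finrank ℚ K, e.finrank_eq, Module.finrank_finsupp_self,
      Nat.card_eq_fintype_card]
  exact (LinearMap.injective_iff_surjective_of_finrank_eq_finrank hfin).2 hsurj

theorem free_and_finrank_eq_one {α : K}
    (hα : {x : K | IsIntegral ℤ x} =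
      {x : K | ∃ γ ∈ associatedOrder ℚ K, groupAlgebraAction ℚ K γ α = x}) :
    Module.Free (associatedOrder ℚ K) (𝓞 K) ∧
      Module.finrank (associatedOrder ℚ K) (𝓞 K) = 1 := by
  have hint : IsIntegral ℤ α := by
    have : α ∈ {x : K | ∃ γ ∈ associatedOrder ℚ K, groupAlgebraAction ℚ K γ α = x} :=
      ⟨1, one_mem _, by simp⟩
    rwa [← hα] at this
  have hinj := groupAlgebraAction_apply_injective fun x hx => hα.subset hx
  let e := LinearEquiv.ofBijective
    (LinearMap.toSpanSingleton (associatedOrder ℚ K) (𝓞 K) ⟨α, hint⟩)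
    ⟨fun a b h => Subtype.ext (hinj (congrArg (algebraMap (𝓞 K) K) h)), fun x => by
      obtain ⟨γ, hγ, h⟩ := hα.subset x.2
      exact ⟨⟨γ, hγ⟩, NumberField.RingOfIntegers.ext h⟩⟩
  -- Commutativity of the Galois group makes the order a commutative ring, so ranks over it are well
  -- behaved.
  let _ : CommRing (associatedOrder ℚ K) :=
    { (inferInstance : Ring (associatedOrder ℚ K)) with
      mul_comm := fun a b => Subtype.ext (MonoidAlgebra.mul_comm_of_isMulCommutative a.1 b.1) }
  exact ⟨Module.Free.of_equiv e, by rw [← e.finrank_eq, Module.finrank_self]⟩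

end Free

theorem rad_dvd_of_primeFactors_subset {n k : ℕ} (h : n.primeFactors ⊆ k.primeFactors) :
    rad n ∣ k :=
  (Finset.prod_dvd_prod_of_subset _ _ _ h).trans (Nat.prod_primeFactors_dvd k)

/-! ### The generator for the full cyclotomic field -/

section Cyclotomic

variable {L : Type*} [Field L] {n : ℕ} [NeZero n]

theorem mem_divisorSet {d : ℕ} : d ∈ divisorSet n ↔ d ∣ n ∧ rad n ∣ d := by
  simp [divisorSet, NeZero.ne n]

theorem coprime_of_mem_divisorSet {d i : ℕ} (hd : d ∈ divisorSet n) (hi : i.Coprime d) :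
    i.Coprime n := by
  refine Nat.coprime_of_dvd fun p hp hpi hpn => ?_
  have : p ∣ d := (Finset.dvd_prod_of_mem (fun p => p)
    (Nat.mem_primeFactors.2 ⟨hp, hpn, NeZero.ne n⟩)).trans (mem_divisorSet.1 hd).2
  exact hp.one_lt.ne' (Nat.eq_one_of_dvd_coprimes hi hpi this)

theorem isIntegral_of_pow_eq_one {x : L} (hx : x ^ n = 1) : IsIntegral ℤ x :=
  ⟨Polynomial.X ^ n - 1, Polynomial.monic_X_pow_sub_C 1 (NeZero.ne n), by simp [hx]⟩

theorem isPrimitiveRoot_pow_div {ζ : L} (hζ : IsPrimitiveRoot ζ n) {d : ℕ} (hd : d ∣ n) :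
    IsPrimitiveRoot (ζ ^ (n / d)) d :=
  hζ.pow (NeZero.pos n) (Nat.div_mul_cancel hd).symm

/-- The `n`-th roots of unity of an order divisible by all primes dividing `n` span the others. -/
theorem mem_span_of_pow_eq_one {ζ : L} (hζ : IsPrimitiveRoot ζ n) {x : L} (hx : x ^ n = 1) :
    x ∈ Submodule.span ℤ {y : L | orderOf y ∈ divisorSet n} := by
  induction hk : (n.primeFactors \ (orderOf x).primeFactors).card using Nat.strong_induction_on
    generalizing x with
  | _ k ih =>
    have hxn : orderOf x ∣ n := orderOf_dvd_of_pow_eq_one hx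
    have hx0 : orderOf x ≠ 0 := fun h => NeZero.ne n (Nat.eq_zero_of_zero_dvd (h ▸ hxn))
    by_cases hsub : n.primeFactors ⊆ (orderOf x).primeFactors
    · exact Submodule.subset_span (mem_divisorSet.2 ⟨hxn, rad_dvd_of_primeFactors_subset hsub⟩)
    obtain ⟨p, hpn, hpx⟩ := Finset.not_subset.1 hsub
    have hp := Nat.prime_of_mem_primeFactors hpn
    have hη := isPrimitiveRoot_pow_div hζ (Nat.dvd_of_mem_primeFactors hpn)
    set η := ζ ^ (n / p)
    have hηn : η ^ n = 1 := (hη.pow_eq_one_iff_dvd n).2 (Nat.dvd_of_mem_primeFactors hpn)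
    have hpx' : ¬ p ∣ orderOf x := fun h => hpx (Nat.mem_primeFactors.2 ⟨hp, h, hx0⟩)
    -- Each term on the right has order `orderOf x * p`, so it misses one prime fewer.
    have hsum : x = - ∑ i ∈ Finset.Ico 1 p, x * η ^ i := by
      have := hη.geom_sum_eq_zero hp.one_lt
      rw [Finset.range_eq_Ico, Finset.sum_eq_sum_Ico_succ_bot hp.pos, pow_zero] at this
      rw [← Finset.mul_sum, eq_neg_of_add_eq_zero_right this]
      simp
    rw [hsum]
    refine neg_mem (sum_mem fun i hi => ?_)
    rw [Finset.mem_Ico] at hi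
    have hηi : orderOf (η ^ i) = p := by
      refine ((hη.pow_of_coprime i ?_).eq_orderOf).symm
      exact (Nat.coprime_of_lt_prime (by omega) hi.2 hp).symm
    have hord : orderOf (x * η ^ i) = orderOf x * p := by
      rw [(Commute.all x (η ^ i)).orderOf_mul_eq_mul_orderOf_of_coprime, hηi]
      rw [hηi]
      exact ((Nat.Prime.coprime_iff_not_dvd hp).2 hpx').symm
    refine ih _ ?_ (x := x * η ^ i) (by rw [mul_pow, hx, pow_right_comm, hηn]; simp) rfl
    rw [← hk, hord, Nat.primeFactors_mul hx0 hp.ne_zero, hp.primeFactors]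
    refine Finset.card_lt_card (Finset.ssubset_iff_of_subset ?_ |>.2 ⟨p, ?_, ?_⟩)
    · exact Finset.sdiff_subset_sdiff subset_rfl Finset.subset_union_left
    · exact Finset.mem_sdiff.2 ⟨hpn, hpx⟩
    · simp

variable [NumberField L] [IsCyclotomicExtension {n} ℚ L]

variable (L) in
theorem exists_gal_apply_eq_pow {a : ℕ} (ha : a.Coprime n) :
    ∃ σ : Gal(L/ℚ), ∀ x : L, x ^ n = 1 → σ x = x ^ a := by
  refine ⟨(IsCyclotomicExtension.Rat.galEquivZMod n L).symm (ZMod.unitOfCoprime a ha),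
    fun x hx => ?_⟩
  rw [IsCyclotomicExtension.Rat.galEquivZMod_apply_of_pow_eq n L _ hx, MulEquiv.apply_symm_apply,
    ZMod.coe_unitOfCoprime, ZMod.val_natCast]
  exact (pow_eq_pow_mod a hx).symm

theorem isIntegral_iff_mem_span_pow {ζ : L} (hζ : IsPrimitiveRoot ζ n) {x : L} :
    IsIntegral ℤ x ↔ x ∈ Submodule.span ℤ (Set.range fun i : ℕ => ζ ^ i) := by
  have := IsCyclotomicExtension.Rat.isIntegralClosure_adjoin_singleton hζ
  have hspan : Submodule.span ℤ (Set.range fun i : ℕ => ζ ^ i) =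
      Subalgebra.toSubmodule (Algebra.adjoin ℤ {ζ}) := by
    rw [Algebra.adjoin_eq_span, ← Submonoid.powers_eq_closure]
    rfl
  rw [IsIntegralClosure.isIntegral_iff (A := Algebra.adjoin ℤ {ζ}), hspan,
    Subalgebra.mem_toSubmodule]
  exact ⟨fun ⟨y, hy⟩ => hy ▸ y.2, fun h => ⟨⟨x, h⟩, rfl⟩⟩

theorem isIntegral_iff_mem_span {ζ : L} (hζ : IsPrimitiveRoot ζ n) {x : L} :
    IsIntegral ℤ x ↔ x ∈ Submodule.span ℤ {y : L | orderOf y ∈ divisorSet n} := by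
  rw [isIntegral_iff_mem_span_pow hζ]
  refine ⟨fun h => (Submodule.span_le.2 ?_) h, fun h => ?_⟩
  · rintro _ ⟨i, rfl⟩
    exact mem_span_of_pow_eq_one hζ (by rw [pow_right_comm, hζ.pow_eq_one, one_pow])
  · rw [← isIntegral_iff_mem_span_pow hζ]
    refine (Submodule.span_le (p := (integralClosure ℤ L).toSubmodule)).2 (fun y hy => ?_) h
    exact isIntegral_of_pow_eq_one (orderOf_dvd_iff_pow_eq_one.1 (mem_divisorSet.1 hy).1)

variable (L) in
/-- If `d` is divisible by all primes dividing `n`, the group algebra contains the normalized trace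
from `L` to its subfield of `d`-th roots of unity. Among the `n`-th roots of unity, it fixes
those of an order dividing `d` and kills the others. -/
theorem exists_projection {d : ℕ} (hd : d ∈ divisorSet n) :
    ∃ ε : MonoidAlgebra ℚ Gal(L/ℚ), ∀ x : L, orderOf x ∣ n →
      groupAlgebraAction ℚ L ε x = if orderOf x ∣ d then x else 0 := by
  have hdn := (mem_divisorSet.1 hd).1
  have hd0 : d ≠ 0 := fun h => NeZero.ne n (Nat.eq_zero_of_zero_dvd (h ▸ hdn))
  have hnd : (n / d : ℕ) ≠ 0 := (Nat.div_pos (Nat.le_of_dvd (NeZero.pos n) hdn)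
    (Nat.pos_of_ne_zero hd0)).ne'
  -- The exponents `1 + d * j` with `j < n / d` represent the residues mod `n` congruent to `1` mod
  -- `d`. All are units because `rad n ∣ d`, so they give the Galois group over `ℚ(ζ_d)`.
  have hcop (j : ℕ) : (1 + d * j).Coprime n :=
    coprime_of_mem_divisorSet hd (by simp)
  choose σ hσ using fun j => exists_gal_apply_eq_pow L (hcop j)
  refine ⟨∑ j ∈ Finset.range (n / d), MonoidAlgebra.single (σ j) ((n / d : ℕ) : ℚ)⁻¹,
    fun x hx => ?_⟩
  have hx1 : x ^ n = 1 := orderOf_dvd_iff_pow_eq_one.1 hx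
  have hsum : groupAlgebraAction ℚ L
      (∑ j ∈ Finset.range (n / d), MonoidAlgebra.single (σ j) ((n / d : ℕ) : ℚ)⁻¹) x =
      ((n / d : ℕ) : ℚ)⁻¹ • (x * ∑ j ∈ Finset.range (n / d), (x ^ d) ^ j) := by
    rw [map_sum, LinearMap.sum_apply, Finset.mul_sum, Finset.smul_sum]
    refine Finset.sum_congr rfl fun j _ => ?_
    rw [groupAlgebraAction_single, hσ j x hx1, pow_add, pow_one, pow_mul]
  rw [hsum]
  split_ifs with h
  · rw [orderOf_dvd_iff_pow_eq_one.1 h]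
    have : ((n / d : ℕ) : L) ≠ 0 := by exact_mod_cast hnd
    rw [Finset.sum_congr rfl fun j _ => one_pow j, Finset.sum_const, Finset.card_range,
      nsmul_eq_mul, mul_one, Algebra.smul_def, map_inv₀, map_natCast]
    field_simp
  · rw [geom_sum_eq (fun h' => h (orderOf_dvd_iff_pow_eq_one.2 h')), ← pow_mul,
      Nat.mul_div_cancel' hdn, hx1]
    simp

theorem mem_associatedOrder_of_projection {ζ : L} (hζ : IsPrimitiveRoot ζ n) {d : ℕ}
    {ε : MonoidAlgebra ℚ Gal(L/ℚ)} (hε : ∀ x : L, orderOf x ∣ n →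
      groupAlgebraAction ℚ L ε x = if orderOf x ∣ d then x else 0) : ε ∈ associatedOrder ℚ L := by
  intro x hx
  rw [isIntegral_iff_mem_span hζ] at hx
  induction hx using Submodule.span_induction with
  | mem y hy =>
    rw [hε y (mem_divisorSet.1 hy).1]
    split_ifs
    · exact isIntegral_of_pow_eq_one (orderOf_dvd_iff_pow_eq_one.1 (mem_divisorSet.1 hy).1)
    · exact isIntegral_zero
  | zero => simpa using isIntegral_zero
  | add y z _ _ hy hz => rw [map_add]; exact hy.add hz
  | smul a y _ hy => rw [map_zsmul]; exact hy.smul a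

/-- The sum of the roots of unity `ζ ^ (n / d)`, `d ∈ divisorSet n`, generates the ring of integers
of the `n`-th cyclotomic field over its associated order. -/
theorem exists_groupAlgebraAction_sum_eq {ζ : L} (hζ : IsPrimitiveRoot ζ n) {x : L}
    (hx : IsIntegral ℤ x) : ∃ γ ∈ associatedOrder ℚ L,
      groupAlgebraAction ℚ L γ (∑ d ∈ divisorSet n, ζ ^ (n / d)) = x := by
  set β := ∑ d ∈ divisorSet n, ζ ^ (n / d)
  let S : AddSubgroup L :=
    (associatedOrder ℚ L).toAddSubgroup.map
      ((LinearMap.applyₗ β).comp (groupAlgebraAction ℚ L).toLinearMap).toAddMonoidHom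
  have hS (y : L) : y ∈ S ↔ ∃ γ ∈ associatedOrder ℚ L, groupAlgebraAction ℚ L γ β = y := Iff.rfl
  have hroot : ∀ d, d ∈ divisorSet n → ζ ^ (n / d) ∈ S := by
    intro d
    induction d using Nat.strong_induction_on with
    | _ d ih =>
      intro hd
      obtain ⟨ε, hε⟩ := exists_projection L hd
      -- The projection leaves the summands with `k ∣ d`; those with `k < d` are in `S` by
      -- induction, which isolates the summand for `d`.
      have hεβ : groupAlgebraAction ℚ L ε β =
          ∑ k ∈ divisorSet n with k ∣ d, ζ ^ (n / k) := by
        rw [map_sum, Finset.sum_filter]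
        refine Finset.sum_congr rfl fun k hk => ?_
        have := (isPrimitiveRoot_pow_div hζ (mem_divisorSet.1 hk).1).eq_orderOf
        rw [hε _ (this ▸ (mem_divisorSet.1 hk).1), ← this]
      have h1 : groupAlgebraAction ℚ L ε β ∈ S :=
        ⟨ε, mem_associatedOrder_of_projection hζ hε, rfl⟩
      have hdd : d ∈ (divisorSet n).filter (· ∣ d) := Finset.mem_filter.2 ⟨hd, dvd_rfl⟩
      rw [hεβ, ← Finset.add_sum_erase _ (fun k => ζ ^ (n / k)) hdd] at h1
      refine (AddSubgroup.add_mem_cancel_right _ (sum_mem fun k hk => ?_)).1 h1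
      obtain ⟨hkd, hk⟩ := Finset.mem_erase.1 hk
      obtain ⟨hk, hk'⟩ := Finset.mem_filter.1 hk
      have hd0 : 0 < d := Nat.pos_of_dvd_of_pos (mem_divisorSet.1 hd).1 (NeZero.pos n)
      exact ih k (lt_of_le_of_ne (Nat.le_of_dvd hd0 hk') hkd) hk
  rw [isIntegral_iff_mem_span hζ] at hx
  rw [← hS]
  refine (Submodule.span_le (p := AddSubgroup.toIntSubmodule S)).2 (fun y hy => ?_) hx
  have hd0 : 0 < orderOf y := Nat.pos_of_dvd_of_pos (mem_divisorSet.1 hy).1 (NeZero.pos n)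
  have : NeZero (orderOf y) := ⟨hd0.ne'⟩
  -- With `d = orderOf y`, the root `y` is the `i`-th power of `ζ ^ (n / d)`, and `i`, prime to `d`,
  -- is prime to `n`. So `y` is a Galois conjugate of that summand.
  obtain ⟨i, -, hi, hiy⟩ := (isPrimitiveRoot_pow_div hζ
    (mem_divisorSet.1 hy).1).isPrimitiveRoot_iff.1 (IsPrimitiveRoot.orderOf y)
  obtain ⟨σ, hσ⟩ := exists_gal_apply_eq_pow L (coprime_of_mem_divisorSet hy hi)
  obtain ⟨γ, hγ, hγ'⟩ := (hS _).1 (hroot _ hy)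
  refine (hS _).2 ⟨MonoidAlgebra.single σ 1 * γ, mul_mem (fun z hz => ?_) hγ, ?_⟩
  · rw [groupAlgebraAction_single, one_smul]
    exact hz.map (σ.toAlgHom.restrictScalars ℤ)
  · rw [map_mul, Module.End.mul_apply, hγ', groupAlgebraAction_single, one_smul, hσ, hiy]
    rw [pow_right_comm, hζ.pow_eq_one, one_pow]

end Cyclotomic

/-! ### Independence of characters, inertia and surjectivity of the tame trace -/

/-- If a finite sum of multiplicative characters vanishes, then the multiplicity of each of them
vanishes in the target ring. -/
theorem card_fiber_eq_zero_of_sum_eq_zero {ι M F : Type*} [Fintype ι] [Monoid M] [CommRing F]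
    [IsDomain F] (φ : ι → M →* F) (h : ∀ x, ∑ i, φ i x = 0) (i : ι) :
    (Nat.card {j // φ j = φ i} : F) = 0 := by
  classical
  have hli := linearIndependent_iff'.1 (linearIndependent_monoidHom M F) (Finset.univ.image φ)
    (fun f => (Finset.card {j | φ j = f} : F)) (by
      ext x
      rw [Finset.sum_apply, Pi.zero_apply, ← h x,
        Finset.sum_comp (fun f : M →* F => f x) φ]
      exact Finset.sum_congr rfl fun f _ => by simp)
    (φ i) (Finset.mem_image_of_mem φ (Finset.mem_univ i))
  rwa [Nat.card_eq_fintype_card, Fintype.card_subtype]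

theorem natCast_mem_iff_dvd {A : Type*} [CommRing A] {P : Ideal A} (hP : P ≠ ⊤) {p : ℕ}
    (hp : p.Prime) (hpP : (p : A) ∈ P) {k : ℕ} : (k : A) ∈ P ↔ p ∣ k := by
  refine ⟨fun hk => ?_, fun ⟨c, hc⟩ => ?_⟩
  · by_contra hdvd
    have hcop := Nat.isCoprime_iff_coprime.2 ((Nat.Prime.coprime_iff_not_dvd hp).2 hdvd)
    obtain ⟨a, b, hab⟩ := hcop
    refine hP ((Ideal.eq_top_iff_one P).2 ?_)
    have : ((a * p + b * k : ℤ) : A) = 1 := by rw [hab, Int.cast_one]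
    rw [← this]
    push_cast
    exact add_mem (P.mul_mem_left _ hpP) (P.mul_mem_left _ hk)
  · rw [hc, Nat.cast_mul]
    exact P.mul_mem_right _ hpP

/-- The characters `x ↦ σ x mod P` sum to zero, so by independence each multiplicity is zero in `A ⧸
P`. The automorphisms with the same character as `1` form the inertia group. -/
theorem dvd_card_inertia_of_sum_mem {G A : Type*} [Group G] [Fintype G] [CommRing A]
    [MulSemiringAction G A] {P : Ideal A} [P.IsPrime] {p : ℕ} (hp : p.Prime) (hpP : (p : A) ∈ P)
    (h : ∀ x : A, ∑ σ : G, σ • x ∈ P) : p ∣ Nat.card (P.inertia G) := by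
  let φ (σ : G) : A →* A ⧸ P :=
    ((Ideal.Quotient.mk P).comp (MulSemiringAction.toRingHom G A σ)).toMonoidHom
  have hφ : ∀ x, ∑ σ, φ σ x = 0 := fun x => by
    have := Ideal.Quotient.eq_zero_iff_mem.2 (h x)
    rwa [map_sum] at this
  have hcard := card_fiber_eq_zero_of_sum_eq_zero φ hφ 1
  have hmem (σ : G) : φ σ = φ 1 ↔ σ ∈ P.inertia G := by
    rw [MonoidHom.ext_iff, AddSubgroup.mem_inertia]
    refine forall_congr' fun x => ?_
    have : φ 1 x = Ideal.Quotient.mk P x := congrArg _ (one_smul G x)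
    rw [this]
    exact Ideal.Quotient.eq
  rw [Nat.card_congr (Equiv.subtypeEquivRight hmem), ← map_natCast (Ideal.Quotient.mk P),
    Ideal.Quotient.eq_zero_iff_mem, natCast_mem_iff_dvd (Ideal.IsPrime.ne_top ‹_›) hp hpP] at hcard
  exact hcard

section NumberField

variable {K L : Type*} [Field K] [Field L] [NumberField L] [Algebra K L]

theorem exists_prime_natCast_mem {P : Ideal (𝓞 L)} [P.IsPrime] (hP : P ≠ ⊥) :
    ∃ p : ℕ, p.Prime ∧ (p : 𝓞 L) ∈ P := by
  have := Ideal.finiteQuotientOfFreeOfNeBot P hP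
  obtain ⟨p, hp⟩ := CharP.exists (𝓞 L ⧸ P)
  refine ⟨p, CharP.char_is_prime (𝓞 L ⧸ P) p, ?_⟩
  rw [← Ideal.Quotient.eq_zero_iff_mem, map_natCast, CharP.cast_eq_zero]

/-- An ideal of `𝓞 K` which is not contained in any ideal below a nonzero prime ideal of `𝓞 L` is
the unit ideal. -/
theorem eq_top_of_forall_prime (J : Ideal (𝓞 K))
    (h : ∀ (P : Ideal (𝓞 L)), P.IsPrime → P ≠ ⊥ → ¬ J ≤ P.under (𝓞 K)) : J = ⊤ := by
  by_contra hJ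
  obtain ⟨M, hM, hJM⟩ := Ideal.exists_le_maximal J hJ
  obtain ⟨P, hP, hPM⟩ := Ideal.exists_maximal_ideal_liesOver_of_isIntegral (S := 𝓞 L) M
  refine h P hP.isPrime ?_ (hPM.over ▸ hJM)
  exact Ring.ne_bot_of_isMaximal_of_not_isField hP (NumberField.RingOfIntegers.not_isField L)

variable [NumberField K] [IsGalois K L]

theorem card_inertia_eq_ramificationIdx {P : Ideal (𝓞 L)} [P.IsPrime] (hP : P ≠ ⊥) :
    Nat.card (P.inertia Gal(L/K)) = P.ramificationIdx (𝓞 K) := by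
  have : (P.under (𝓞 K)).IsMaximal :=
    Ring.DimensionLEOne.maximalOfPrime (Ideal.under_ne_bot (𝓞 K) hP) inferInstance
  have := Ideal.finiteQuotientOfFreeOfNeBot (P.under (𝓞 K)) (Ideal.under_ne_bot (𝓞 K) hP)
  rw [Ideal.card_inertia_eq_ramificationIdxIn (P.under (𝓞 K)) P,
    Ideal.ramificationIdxIn_eq_ramificationIdx (P.under (𝓞 K)) P Gal(L/K)]

theorem algebraMap_intTrace_eq_sum (x : 𝓞 L) :
    algebraMap (𝓞 K) (𝓞 L) (Algebra.intTrace (𝓞 K) (𝓞 L) x) = ∑ σ : Gal(L/K), σ • x := by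
  apply NumberField.RingOfIntegers.ext
  refine Eq.trans ?_ (map_sum (algebraMap (𝓞 L) L) _ _).symm
  change algebraMap (𝓞 L) L (algebraMap (𝓞 K) (𝓞 L) _) = ∑ σ : Gal(L/K), σ (x : L)
  rw [← trace_eq_sum_automorphisms, ← Algebra.algebraMap_intTrace (A := 𝓞 K) (B := 𝓞 L) (K := K),
    ← IsScalarTower.algebraMap_apply, ← IsScalarTower.algebraMap_apply]

/-- The trace of a tamely ramified Galois extension is surjective on rings of integers. -/
theorem IsTame.exists_trace_eq (h : IsTame K L) {z : K} (hz : IsIntegral ℤ z) :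
    ∃ y : L, IsIntegral ℤ y ∧ Algebra.trace K L y = z := by
  have htop : LinearMap.range (Algebra.intTrace (𝓞 K) (𝓞 L)) = ⊤ := by
    refine eq_top_of_forall_prime (L := L) _ fun P hP hP0 hle => ?_
    obtain ⟨p, hp, hpP⟩ := exists_prime_natCast_mem hP0
    refine h P hP hP0 p hp hpP ?_
    rw [← card_inertia_eq_ramificationIdx hP0]
    refine dvd_card_inertia_of_sum_mem hp hpP fun x => ?_
    rw [← algebraMap_intTrace_eq_sum]
    exact hle ⟨x, rfl⟩
  obtain ⟨y, hy⟩ := LinearMap.range_eq_top.1 htop ⟨z, hz⟩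
  exact ⟨y, y.2, by
    rw [← Algebra.algebraMap_intTrace (A := 𝓞 K) (B := 𝓞 L) (K := K), hy]; rfl⟩

end NumberField

/-! ### Exponents of automorphisms on roots of unity -/

section RootsOfUnity

theorem _root_.IsPrimitiveRoot.int_dvd_sub_of_pow_eq_pow {F : Type*} [Field F] {ζ : F} {k a b : ℕ}
    (hζ : IsPrimitiveRoot ζ k) (hk : k ≠ 0) (h : ζ ^ a = ζ ^ b) : (k : ℤ) ∣ a - b := by
  have h0 : ζ ≠ 0 := hζ.ne_zero hk
  rw [← hζ.zpow_eq_one_iff_dvd, zpow_sub₀ h0, zpow_natCast, zpow_natCast, h,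
    div_self (pow_ne_zero _ h0)]

theorem _root_.IsPrimitiveRoot.pow_eq_pow_of_int_dvd_sub {F : Type*} [Field F] {ζ : F}
    {k a b : ℕ} (hζ : IsPrimitiveRoot ζ k) (hk : k ≠ 0) (h : (k : ℤ) ∣ a - b) :
    ζ ^ a = ζ ^ b := by
  have h0 : ζ ≠ 0 := hζ.ne_zero hk
  rw [← hζ.zpow_eq_one_iff_dvd, zpow_sub₀ h0, zpow_natCast, zpow_natCast,
    div_eq_one_iff_eq (pow_ne_zero _ h0)] at h
  exact h

theorem _root_.AlgEquiv.pow_apply_eq_pow_pow {K L : Type*} [Field K] [Field L] [Algebra K L]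
    {σ : Gal(L/K)} {x : L} {c : ℕ} (h : σ x = x ^ c) (j : ℕ) : (σ ^ j) x = x ^ c ^ j := by
  induction j with
  | zero => simp
  | succ j ih => rw [pow_succ, AlgEquiv.mul_apply, h, map_pow, ih, ← pow_mul, pow_succ]

theorem exists_apply_eq_pow {K L : Type*} [Field K] [Field L] [Algebra K L] {ζ : L} {k : ℕ}
    (hζ : IsPrimitiveRoot ζ k) (hk : k ≠ 0) (σ : Gal(L/K)) : ∃ c : ℕ, σ ζ = ζ ^ c := by
  have : NeZero k := ⟨hk⟩
  obtain ⟨c, -, hc⟩ := hζ.eq_pow_of_pow_eq_one (ξ := σ ζ)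
    (by rw [← map_pow, hζ.pow_eq_one, map_one])
  exact ⟨c, hc.symm⟩

end RootsOfUnity

/-! ### Minimality of the conductor -/

section Conductor

variable {K L : Type*} [Field K] [NumberField K] [Field L] [NumberField L] [Algebra K L]
  {n : ℕ} [NeZero n] [IsCyclotomicExtension {n} ℚ L]

theorem eq_one_of_apply_primitiveRoot {ζ : L} (hζ : IsPrimitiveRoot ζ n) {σ : Gal(L/K)}
    (h : σ ζ = ζ) : σ = 1 := by
  have : (σ.restrictScalars ℚ : L →ₐ[ℚ] L) = AlgHom.id ℚ L :=
    (hζ.powerBasis ℚ).algHom_ext (by simpa using h)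
  ext x
  exact DFunLike.congr_fun this x

/-- A nontrivial automorphism of order `p` over a field of conductor `n` moves some root of unity of
order `n / p`. -/
theorem IsConductor.eq_one_of_apply_pow (hn : IsConductor K n) {ζ : L} (hζ : IsPrimitiveRoot ζ n)
    {p : ℕ} (hp : p.Prime) (hpn : p ∣ n) {σ : Gal(L/K)} (hσp : σ ^ p = 1)
    (hσ : σ (ζ ^ p) = ζ ^ p) : σ = 1 := by
  by_contra hσ1
  obtain ⟨k, hk⟩ := hpn
  have hk0 : k ≠ 0 := by rintro rfl; exact NeZero.ne n hk
  have : NeZero k := ⟨hk0⟩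
  have hζp : IsPrimitiveRoot (ζ ^ p) k := hζ.pow (NeZero.pos n) hk
  let F := IntermediateField.adjoin ℚ {ζ ^ p}
  have hF : IsCyclotomicExtension {k} ℚ F :=
    hζp.intermediateField_adjoin_isCyclotomicExtension ℚ
  have hFrank : Module.finrank ℚ F = k.totient :=
    IsCyclotomicExtension.finrank F (Polynomial.cyclotomic.irreducible_rat (NeZero.pos k))
  have hLrank : Module.finrank ℚ L = n.totient :=
    IsCyclotomicExtension.finrank L (Polynomial.cyclotomic.irreducible_rat (NeZero.pos n))
  let τ : Gal(L/ℚ) := σ.restrictScalars ℚ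
  have hτ : orderOf τ = p := by
    have := Fact.mk hp
    refine orderOf_eq_prime ?_ fun h => hσ1 ?_
    · ext x
      have := DFunLike.congr_fun hσp x
      have hpow (j : ℕ) : (τ ^ j) x = (σ ^ j) x := by
        induction j with
        | zero => rfl
        | succ j ih => rw [pow_succ', pow_succ', AlgEquiv.mul_apply, AlgEquiv.mul_apply, ih]; rfl
      rw [hpow, this]
      rfl
    · ext x
      exact DFunLike.congr_fun h x
  let E := IntermediateField.fixedField (Subgroup.zpowers τ)
  have hE : Module.finrank ℚ E * p = n.totient := by
    rw [← hLrank, ← Module.finrank_mul_finrank ℚ E L,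
      IntermediateField.finrank_fixedField_eq_card, Nat.card_zpowers, hτ]
  have hFE : F ≤ E := by
    rw [IntermediateField.adjoin_simple_le_iff, IntermediateField.mem_fixedField_iff]
    rintro _ ⟨i, rfl⟩
    have : τ ∈ MulAction.stabilizer Gal(L/ℚ) (ζ ^ p) := hσ
    exact zpow_mem this i
  -- The fixed field `E` of `τ` has degree `φ(n) / p ≤ φ(k)` and contains `ℚ(ζ ^ p)`, of degree
  -- `φ(k)`. So they coincide and `K` embeds in the `k`-th cyclotomic field with `k < n`.
  have htot : n.totient ≤ p * k.totient := by
    rw [hk]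
    by_cases hpk : p ∣ k
    · rw [Nat.totient_mul_of_prime_of_dvd hp hpk]
    · rw [Nat.totient_mul_of_prime_of_not_dvd hp hpk]
      exact Nat.mul_le_mul_right _ (Nat.sub_le _ _)
  have hEF : F = E := by
    refine IntermediateField.eq_of_le_of_finrank_le hFE ?_
    rw [hFrank]
    refine Nat.le_of_mul_le_mul_right ?_ hp.pos
    rw [hE, mul_comm]
    exact htot
  have hKE (x : K) : algebraMap K L x ∈ F := by
    rw [hEF, IntermediateField.mem_fixedField_iff]
    rintro _ ⟨i, rfl⟩
    have : τ ∈ MulAction.stabilizer Gal(L/ℚ) (algebraMap K L x) := σ.commutes x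
    exact zpow_mem this i
  let f : K →ₐ[ℚ] F := (IsScalarTower.toAlgHom ℚ K L).codRestrict F.toSubalgebra hKE
  have e : F ≃+* CyclotomicField k ℚ :=
    (@IsCyclotomicExtension.algEquiv {k} ℚ F _ _ _ hF (CyclotomicField k ℚ) _
      (CyclotomicField.algebra k ℚ) inferInstance).toRingEquiv
  have hle := hn.2 ⟨NeZero.pos k, ⟨(e.toRingHom.comp f.toRingHom).toRatAlgHom⟩⟩
  have hk1 := NeZero.pos k
  have := hp.two_le
  nlinarith

end Conductor

/-! ### Inertia and roots of unity of order prime to `p` -/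

section Inertia

variable {L : Type*} [Field L]

/-- Roots of unity of an order prime to the residue characteristic are distinct modulo `P`. -/
theorem eq_of_sub_mem_of_pow_eq_one {P : Ideal (𝓞 L)} [P.IsPrime] {p : ℕ} (hp : p.Prime)
    (hpP : (p : 𝓞 L) ∈ P) {k : ℕ} (hk : ¬ p ∣ k) {X Z : 𝓞 L} (hX : X ^ k = 1) (hZ : Z ^ k = 1)
    (hXZ : Z - X ∈ P) : Z = X := by
  have hk0 : k ≠ 0 := fun h => hk (h ▸ dvd_zero p)
  have hXX : X ^ (k - 1) * X = 1 := by
    rw [← pow_succ, Nat.sub_add_cancel (Nat.pos_of_ne_zero hk0), hX]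
  -- `Y` is the quotient `Z / X`. If `Y ≠ 1`, the vanishing sum of its first `k` powers reduces to
  -- `k = 0` modulo `P`.
  set Y := X ^ (k - 1) * Z
  have hY : Y ^ k = 1 := by rw [mul_pow, hZ, pow_right_comm, hX, one_pow, one_mul]
  have hYP : Y - 1 ∈ P := by
    have : Y - 1 = X ^ (k - 1) * (Z - X) := by rw [mul_sub, hXX]
    rw [this]
    exact P.mul_mem_left _ hXZ
  have hY1 : Y = 1 := by
    by_contra hne
    have hsum : ∑ i ∈ Finset.range k, Y ^ i = 0 := by
      have := geom_sum_mul Y k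
      rw [hY, sub_self] at this
      exact (mul_eq_zero.1 this).resolve_right (sub_ne_zero.2 hne)
    have hmk : Ideal.Quotient.mk P Y = 1 := by
      rw [← map_one (Ideal.Quotient.mk P)]
      exact Ideal.Quotient.eq.2 hYP
    have := congrArg (Ideal.Quotient.mk P) hsum
    simp only [map_sum, map_pow, hmk, one_pow, Finset.sum_const, Finset.card_range, nsmul_eq_mul,
      mul_one, map_zero] at this
    rw [← map_natCast (Ideal.Quotient.mk P), Ideal.Quotient.eq_zero_iff_mem,
      natCast_mem_iff_dvd (Ideal.IsPrime.ne_top ‹_›) hp hpP] at this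
    exact hk this
  calc Z = X * Y := by rw [← mul_assoc, mul_comm X, hXX, one_mul]
    _ = X := by rw [hY1, mul_one]

theorem apply_eq_of_mem_inertia {K : Type*} [Field K] [Algebra K L] {P : Ideal (𝓞 L)} [P.IsPrime]
    {p : ℕ} (hp : p.Prime) (hpP : (p : 𝓞 L) ∈ P) {σ : Gal(L/K)} (hσ : σ ∈ P.inertia Gal(L/K))
    {x : L} {k : ℕ} (hk : ¬ p ∣ k) (hx : x ^ k = 1) : σ x = x := by
  have : NeZero k := ⟨fun h => hk (h ▸ dvd_zero p)⟩
  let X : 𝓞 L := ⟨x, isIntegral_of_pow_eq_one hx⟩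
  have hX : X ^ k = 1 := NumberField.RingOfIntegers.ext hx
  have : σ • X = X :=
    eq_of_sub_mem_of_pow_eq_one hp hpP hk hX (by rw [← smul_pow', hX, smul_one]) (hσ X)
  exact congrArg (algebraMap (𝓞 L) L) this

end Inertia

theorem isPrimitiveRoot_mul {L : Type*} [Field L] {n : ℕ} [NeZero n] {ζ₂ ζₘ : L}
    (h₂ : IsPrimitiveRoot ζ₂ (2 ^ twoExp n)) (hₘ : IsPrimitiveRoot ζₘ (oddPart n)) :
    IsPrimitiveRoot (ζ₂ * ζₘ) n := by
  rw [IsPrimitiveRoot.iff_orderOf,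
    (Commute.all ζ₂ ζₘ).orderOf_mul_eq_mul_orderOf_of_coprime, ← h₂.eq_orderOf,
    ← hₘ.eq_orderOf, two_pow_mul_oddPart]
  rw [← h₂.eq_orderOf, ← hₘ.eq_orderOf]
  exact coprime_oddPart n

/-! ### Wild ramification over a field of conductor `n` -/

section Wild

variable {K L : Type*} [Field K] [NumberField K] [Field L] [NumberField L] [Algebra K L]
  {n : ℕ} [NeZero n] [IsCyclotomicExtension {n} ℚ L]

/-- If `p` divides the order of an inertia group of `L / K` at `p`, then `p = 2`. -/
theorem IsConductor.exists_of_dvd_card_inertia (hn : IsConductor K n) {P : Ideal (𝓞 L)}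
    [P.IsPrime] {p : ℕ} (hp : p.Prime) (hpP : (p : 𝓞 L) ∈ P)
    (hdvd : p ∣ Nat.card (P.inertia Gal(L/K))) :
    p = 2 ∧ ∃ σ : Gal(L/K), orderOf σ = 2 ∧ σ ∈ P.inertia Gal(L/K) := by
  have := Fact.mk hp
  obtain ⟨⟨σ, hσ⟩, hord⟩ := exists_prime_orderOf_dvd_card' p hdvd
  rw [← Subgroup.orderOf_coe] at hord
  have hσp : σ ^ p = 1 := hord ▸ pow_orderOf_eq_one σ
  have hσ1 : σ ≠ 1 := fun h => hp.one_lt.ne' (by rw [← hord]; simp [h])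
  suffices p = 2 by subst this; exact ⟨rfl, σ, hord, hσ⟩
  have hfix {k : ℕ} (hk : ¬ p ∣ k) {x : L} (hx : x ^ k = 1) : σ x = x :=
    apply_eq_of_mem_inertia hp hpP hσ hk hx
  obtain ⟨ζ, hζ⟩ := IsCyclotomicExtension.exists_isPrimitiveRoot ℚ L
    (Set.mem_singleton n) (NeZero.ne n)
  have hpn : p ∣ n := by
    by_contra h
    exact hσ1 (eq_one_of_apply_primitiveRoot hζ (hfix h hζ.pow_eq_one))
  by_contra hp2
  refine hσ1 (hn.eq_one_of_apply_pow hζ hp hpn hσp ?_)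
  obtain ⟨c, hc⟩ := exists_apply_eq_pow hζ (NeZero.ne n) σ
  rw [map_pow, hc, ← pow_mul]
  suffices (n : ℤ) ∣ p * (c - 1) by
    conv_rhs => rw [← one_mul p, mul_comm, pow_mul, ← pow_mul]
    refine hζ.pow_eq_pow_of_int_dvd_sub (NeZero.ne n) ?_
    push_cast
    rwa [mul_one, mul_comm, ← mul_sub_one]
  have hcp : (n : ℤ) ∣ c ^ p - 1 := by
    have := hζ.int_dvd_sub_of_pow_eq_pow (a := c ^ p) (b := 1) (NeZero.ne n) (by
      rw [← AlgEquiv.pow_apply_eq_pow_pow hc, hσp, pow_one]; rfl)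
    exact_mod_cast this
  obtain ⟨a, m, hm, hnm⟩ := Nat.exists_eq_pow_mul_and_not_dvd (NeZero.ne n) p hp.ne_one
  have hmc : (m : ℤ) ∣ c - 1 := by
    have hξ : IsPrimitiveRoot (ζ ^ p ^ a) m := hζ.pow (NeZero.pos n) hnm
    have hm0 : m ≠ 0 := fun h => hm (h ▸ dvd_zero p)
    have := hξ.int_dvd_sub_of_pow_eq_pow (a := c) (b := 1) hm0 (by
      rw [pow_one, pow_right_comm, ← hc, ← map_pow]; exact hfix hm hξ.pow_eq_one)
    exact_mod_cast this
  -- By Fermat, `c ≡ c ^ p ≡ 1` modulo `p`.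
  have hpc : (p : ℤ) ∣ c - 1 := by
    have h1 : (p : ℤ) ∣ c ^ p - 1 := (Int.natCast_dvd_natCast.2 hpn).trans hcp
    rw [← ZMod.intCast_zmod_eq_zero_iff_dvd] at h1 ⊢
    push_cast at h1 ⊢
    rwa [ZMod.pow_card] at h1
  have hpc' : ¬ (p : ℤ) ∣ c := fun h => by
    have := (dvd_sub_right h).1 hpc
    exact hp.one_lt.ne' (by exact_mod_cast Int.eq_one_of_dvd_one (by positivity) this)
  -- Lifting the exponent for odd `p`: `c ^ p - 1` and `p * (c - 1)` have the same `p`-adic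
  -- valuation.
  have hpa : ((p : ℤ) ^ a) ∣ p * (c - 1) := by
    have h1 : (p : ℤ) ^ a ∣ c ^ p - 1 ^ p := by
      rw [one_pow]
      refine dvd_trans ?_ hcp
      rw [hnm]
      push_cast
      exact dvd_mul_right _ _
    rw [pow_dvd_iff_le_emultiplicity, Int.emultiplicity_pow_sub_pow hp (hp.odd_of_ne_two hp2) hpc
      hpc'] at h1
    rw [pow_dvd_iff_le_emultiplicity, emultiplicity_mul (Nat.prime_iff_prime_int.1 hp), add_comm]
    convert h1 using 2
    exact Int.natCast_emultiplicity p p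
  rw [hnm]
  push_cast
  refine IsCoprime.mul_dvd ?_ hpa (hmc.mul_left _)
  exact_mod_cast (Nat.isCoprime_iff_coprime.2
    (((Nat.Prime.coprime_iff_not_dvd hp).2 hm).pow_left a))

variable {ζ₂ ζₘ : L}

theorem eq_one_of_apply_eq (h₂ : IsPrimitiveRoot ζ₂ (2 ^ twoExp n))
    (hₘ : IsPrimitiveRoot ζₘ (oddPart n)) {σ : Gal(L/K)} (hσ₂ : σ ζ₂ = ζ₂) (hσₘ : σ ζₘ = ζₘ) :
    σ = 1 :=
  eq_one_of_apply_primitiveRoot (isPrimitiveRoot_mul h₂ hₘ) (by rw [map_mul, hσ₂, hσₘ])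

theorem IsConductor.eq_one_of_apply_sq (hn : IsConductor K n)
    (h₂ : IsPrimitiveRoot ζ₂ (2 ^ twoExp n)) (hₘ : IsPrimitiveRoot ζₘ (oddPart n))
    {σ : Gal(L/K)} (hσ : σ ^ 2 = 1) (hσ₂ : σ (ζ₂ ^ 2) = ζ₂ ^ 2) (hσₘ : σ ζₘ = ζₘ) :
    σ = 1 := by
  by_cases he : twoExp n = 0
  · refine eq_one_of_apply_eq h₂ hₘ ?_ hσₘ
    rw [he, pow_zero, IsPrimitiveRoot.one_right_iff] at h₂
    rw [h₂, map_one]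
  · refine hn.eq_one_of_apply_pow (isPrimitiveRoot_mul h₂ hₘ) Nat.prime_two ?_ hσ ?_
    · exact Nat.dvd_of_factorization_pos he
    · rw [mul_pow, map_mul, hσ₂, map_pow, hσₘ]

/-- An automorphism over a field of conductor `n` which fixes the roots of unity of odd order and
acts on those of `2`-power order by an exponent congruent to `1` modulo `4` is trivial. -/
theorem IsConductor.eq_one_of_mod_four (hn : IsConductor K n)
    (h₂ : IsPrimitiveRoot ζ₂ (2 ^ twoExp n)) (hₘ : IsPrimitiveRoot ζₘ (oddPart n))
    {σ : Gal(L/K)} {c : ℕ} (hc : c % 4 = 1) (hσ₂ : σ ζ₂ = ζ₂ ^ c) (hσₘ : σ ζₘ = ζₘ) :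
    σ = 1 := by
  -- Induction applied to `σ ^ 2` reduces to `σ ^ 2 = 1`. Then `2 ^ e ∣ (c - 1) * (c + 1)` with `(c
  -- + 1) / 2` odd, so `σ` fixes `ζ₂ ^ 2` and minimality of the conductor applies.
  have key (j : ℕ) : ∀ (σ : Gal(L/K)) (c : ℕ), c % 4 = 1 → σ ζ₂ = ζ₂ ^ c → σ ζₘ = ζₘ →
      σ ^ 2 ^ j = 1 → σ = 1 := by
    induction j with
    | zero => intro σ c _ _ _ h; simpa using h
    | succ j ih =>
      intro σ c hc hσ₂ hσₘ h
      have hsq : σ ^ 2 = 1 := by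
        refine ih (σ ^ 2) (c ^ 2) (by rw [Nat.pow_mod, hc]) (AlgEquiv.pow_apply_eq_pow_pow hσ₂ 2)
          ?_ (by rw [← pow_mul, ← pow_succ', h])
        rw [pow_two, AlgEquiv.mul_apply, hσₘ, hσₘ]
      refine hn.eq_one_of_apply_sq h₂ hₘ hsq ?_ hσₘ
      have hdvd := h₂.int_dvd_sub_of_pow_eq_pow (a := c ^ 2) (b := 1) (by positivity) (by
        rw [← AlgEquiv.pow_apply_eq_pow_pow hσ₂, hsq, pow_one]; rfl)
      rw [map_pow, hσ₂, ← pow_mul]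
      refine h₂.pow_eq_pow_of_int_dvd_sub (by positivity) ?_
      obtain ⟨k, rfl⟩ : ∃ k, c = 4 * k + 1 := ⟨c / 4, by omega⟩
      push_cast at hdvd ⊢
      have hfac : ((4 * k + 1 : ℤ) ^ 2 - 1) = ((4 * k + 1) * 2 - 2) * (2 * k + 1) := by ring
      rw [hfac] at hdvd
      refine IsCoprime.dvd_of_dvd_mul_right (IsCoprime.pow_left ?_) hdvd
      exact ⟨-k, 1, by ring⟩
  refine key (twoExp n - 1) σ c hc hσ₂ hσₘ (eq_one_of_apply_eq h₂ hₘ ?_ ?_)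
  · rw [AlgEquiv.pow_apply_eq_pow_pow hσ₂]
    have hcop : c.Coprime (2 ^ twoExp n) :=
      Nat.Coprime.pow_right _ (Nat.coprime_two_right.2 (Nat.odd_iff.2 (by omega)))
    have := Nat.ModEq.pow_totient hcop
    rw [totient_two_pow] at this
    conv_rhs => rw [← pow_one ζ₂]
    exact h₂.pow_eq_pow_of_int_dvd_sub (by positivity) (Nat.modEq_iff_dvd.1 this.symm)
  · have := AlgEquiv.pow_apply_eq_pow_pow (σ := σ) (x := ζₘ) (c := 1) (by rw [hσₘ, pow_one])
      (2 ^ (twoExp n - 1))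
    rwa [one_pow, pow_one] at this

/-- The structure of the inertia group at `2` of `L / K`, if `L / K` is not tamely ramified. -/
structure IsWildInvolution (n : ℕ) (ζ₂ ζₘ : L) (τ : Gal(L/K)) (s : ℤˣ) : Prop where
  three_le : 3 ≤ twoExp n
  ne_one : τ ≠ 1
  mul_self : τ * τ = 1
  apply_odd : τ ζₘ = ζₘ
  apply_two : τ ζ₂ * ζ₂ = ((s : ℤ) : L)
  eq_one_or_eq : ∀ σ : Gal(L/K), σ ζₘ = ζₘ → σ = 1 ∨ σ = τ

theorem IsConductor.exists_isWildInvolution (hn : IsConductor K n)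
    (h₂ : IsPrimitiveRoot ζ₂ (2 ^ twoExp n)) (hₘ : IsPrimitiveRoot ζₘ (oddPart n))
    [IsGalois K L] (h : ¬ IsTame K L) :
    ∃ (τ : Gal(L/K)) (s : ℤˣ), IsWildInvolution n ζ₂ ζₘ τ s := by
  simp only [IsTame, not_forall, not_not] at h
  obtain ⟨P, hP, hP0, p, hp, hpP, hdvd⟩ := h
  rw [← card_inertia_eq_ramificationIdx hP0] at hdvd
  obtain ⟨rfl, τ, hτ, hτP⟩ := hn.exists_of_dvd_card_inertia hp hpP hdvd
  have hτ1 : τ ≠ 1 := fun h => by simp [h] at hτ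
  have hτ2 : τ ^ 2 = 1 := hτ ▸ pow_orderOf_eq_one τ
  have hodd : ¬ 2 ∣ oddPart n := Nat.not_dvd_ordCompl Nat.prime_two (NeZero.ne n)
  have hτₘ : τ ζₘ = ζₘ :=
    apply_eq_of_mem_inertia hp hpP hτP hodd hₘ.pow_eq_one
  have hmod (σ : Gal(L/K)) (hσ : σ ≠ 1) (hσₘ : σ ζₘ = ζₘ) :
      ∃ c : ℕ, c % 4 = 3 ∧ σ ζ₂ = ζ₂ ^ c := by
    obtain ⟨c, hc⟩ := exists_apply_eq_pow h₂ (by positivity) σ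
    refine ⟨c, ?_, hc⟩
    have he : twoExp n ≠ 0 := fun he => hσ (eq_one_of_apply_eq h₂ hₘ (by
      rw [he, pow_zero, IsPrimitiveRoot.one_right_iff] at h₂
      rw [h₂, map_one]) hσₘ)
    have h4 : c % 4 ≠ 1 := fun h => hσ (hn.eq_one_of_mod_four h₂ hₘ h hc hσₘ)
    have hprim : IsPrimitiveRoot (ζ₂ ^ c) (2 ^ twoExp n) := hc ▸ h₂.map_of_injective σ.injective
    have hcop := (h₂.pow_iff_coprime (by positivity) c).1 hprim
    have := Nat.odd_iff.1 (Nat.coprime_two_right.1 ((Nat.coprime_pow_right_iff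
      (Nat.pos_of_ne_zero he) c 2).1 hcop))
    omega
  obtain ⟨c, hc, hcτ⟩ := hmod τ hτ1 hτₘ
  -- If `e ≤ 2`, then `2 * c ≡ 2` modulo `2 ^ e` since `c` is odd, so `τ` would fix `ζ₂ ^ 2`.
  have he : 3 ≤ twoExp n := by
    by_contra hlt
    refine hτ1 (hn.eq_one_of_apply_sq h₂ hₘ hτ2 ?_ hτₘ)
    rw [map_pow, hcτ, ← pow_mul]
    refine h₂.pow_eq_pow_of_int_dvd_sub (by positivity) ?_
    have h4 : (2 ^ twoExp n : ℕ) ∣ 2 ^ 2 := pow_dvd_pow 2 (by omega)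
    refine (Int.natCast_dvd_natCast.2 h4).trans ?_
    push_cast
    omega
  -- Here `(c - 1) / 2` is odd, so `2 ^ e ∣ c ^ 2 - 1` gives `2 ^ e ∣ 2 * (c + 1)`.
  have hsq : (τ ζ₂ * ζ₂) ^ 2 = 1 := by
    have hdvd := h₂.int_dvd_sub_of_pow_eq_pow (a := c ^ 2) (b := 1) (by positivity) (by
      rw [← AlgEquiv.pow_apply_eq_pow_pow hcτ, hτ2, pow_one]; rfl)
    rw [hcτ, ← pow_succ, ← pow_mul]
    conv_rhs => rw [← pow_zero ζ₂]
    refine h₂.pow_eq_pow_of_int_dvd_sub (by positivity) ?_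
    obtain ⟨k, rfl⟩ : ∃ k, c = 4 * k + 3 := ⟨c / 4, by omega⟩
    push_cast at hdvd ⊢
    have hfac : ((4 * k + 3 : ℤ) ^ 2 - 1) = ((4 * k + 3 + 1) * 2 - 0) * (2 * k + 1) := by ring
    rw [hfac] at hdvd
    refine IsCoprime.dvd_of_dvd_mul_right (IsCoprime.pow_left ?_) hdvd
    exact ⟨-k, 1, by ring⟩
  obtain ⟨s, hs⟩ : ∃ s : ℤˣ, τ ζ₂ * ζ₂ = ((s : ℤ) : L) := by
    rcases sq_eq_sq_iff_eq_or_eq_neg.1 (hsq.trans (one_pow 2).symm) with h | h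
    · exact ⟨1, by simp [h]⟩
    · exact ⟨-1, by simp [h]⟩
  refine ⟨τ, s, he, hτ1, by rw [← pow_two, hτ2], hτₘ, hs, fun σ hσ => ?_⟩
  by_cases hσ1 : σ = 1
  · exact .inl hσ1
  obtain ⟨d, hd, hdσ⟩ := hmod σ hσ1 hσ
  -- Two exponents congruent to `3` modulo `4` have a product congruent to `1`.
  have : σ * τ = 1 := by
    refine hn.eq_one_of_mod_four h₂ hₘ (c := d * c) (by rw [Nat.mul_mod, hd, hc]) ?_ ?_
    · rw [AlgEquiv.mul_apply, hcτ, map_pow, hdσ, pow_mul]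
    · rw [AlgEquiv.mul_apply, hτₘ, hσ]
  refine .inr ?_
  rw [eq_inv_of_mul_eq_one_left this, inv_eq_of_mul_eq_one_left (by rw [← pow_two, hτ2])]

end Wild

/-! ### Equivariance of the trace -/

section TraceEquivariant

variable {K L : Type*} [Field K] [NumberField K] [IsGalois ℚ K] [Field L] [NumberField L]
  [Algebra K L] [IsAbelianGalois ℚ L]

/-- The trace is the sum over `Gal(L/K)`, whose elements commute with `σ` because `Gal(L/ℚ)` is
abelian. -/
theorem trace_apply_eq_restrictNormal (σ : Gal(L/ℚ)) (x : L) :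
    Algebra.trace K L (σ x) = AlgEquiv.restrictNormal σ K (Algebra.trace K L x) := by
  have : IsGalois K L := IsGalois.tower_top_of_isGalois ℚ K L
  apply (algebraMap K L).injective
  rw [AlgEquiv.restrictNormal_commutes, trace_eq_sum_automorphisms, trace_eq_sum_automorphisms,
    map_sum]
  refine Finset.sum_congr rfl fun h _ => ?_
  exact DFunLike.congr_fun (IsMulCommutative.is_comm.comm (h.restrictScalars ℚ : Gal(L/ℚ)) σ) x

variable (K L) in
theorem isEquivariant_trace : IsEquivariant ((Algebra.trace K L).restrictScalars ℚ) :=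
  fun σ x => trace_apply_eq_restrictNormal σ x

end TraceEquivariant

/-! ### Half traces of `τ`-fixed integers -/

section HalfTraceIdeal

variable {K L : Type*} [Field K] [NumberField K] [Field L] [NumberField L] [Algebra K L]

/-- The elements `z` of `𝓞 K` such that `2 z` is the trace of an element of `𝓞 L` fixed by `τ`. -/
def halfTraceIdeal (τ : Gal(L/K)) : Ideal (𝓞 K) where
  carrier := {z | ∃ x : 𝓞 L, τ • x = x ∧ Algebra.intTrace (𝓞 K) (𝓞 L) x = 2 * z}
  add_mem' := by
    rintro a b ⟨x, hx, hx'⟩ ⟨y, hy, hy'⟩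
    exact ⟨x + y, by rw [smul_add, hx, hy], by rw [map_add, hx', hy', mul_add]⟩
  zero_mem' := ⟨0, smul_zero _, by simp⟩
  smul_mem' := by
    rintro c z ⟨x, hx, hx'⟩
    have hc : τ • algebraMap (𝓞 K) (𝓞 L) c = algebraMap (𝓞 K) (𝓞 L) c :=
      NumberField.RingOfIntegers.ext (τ.commutes c)
    exact ⟨c • x, by rw [Algebra.smul_def, smul_mul', hc, hx],
      by rw [map_smul, hx']; simp [mul_left_comm]⟩

theorem mem_halfTraceIdeal {τ : Gal(L/K)} {z : 𝓞 K} : z ∈ halfTraceIdeal τ ↔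
    ∃ x : 𝓞 L, τ • x = x ∧ Algebra.intTrace (𝓞 K) (𝓞 L) x = 2 * z := Iff.rfl

end HalfTraceIdeal

section Wild

variable {K L : Type*} [Field K] [NumberField K] [Field L] [NumberField L] [Algebra K L]
  {n : ℕ} {ζ₂ ζₘ : L} {τ : Gal(L/K)} {s : ℤˣ}

namespace IsWildInvolution

variable (hτ : IsWildInvolution n ζ₂ ζₘ τ s)

include hτ

/-- The conjugates of `ζₘ` over `K` each occur twice in a sum over the Galois group. -/
theorem sum_comp_apply {A M : Type*} [DecidableEq A] [AddCommMonoid M] (f : Gal(L/K) → A)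
    (hf : ∀ σ ρ, f σ = f ρ ↔ σ ζₘ = ρ ζₘ) (g : A → M) :
    ∑ σ, g (f σ) = 2 • ∑ η ∈ Finset.univ.image f, g η := by
  classical
  rw [Finset.sum_comp g f, Finset.smul_sum]
  refine Finset.sum_congr rfl fun η hη => ?_
  obtain ⟨σ, -, rfl⟩ := Finset.mem_image.1 hη
  congr 1
  have : Finset.filter (fun ρ => f ρ = f σ) Finset.univ = {σ, σ * τ} := by
    ext ρ
    simp only [Finset.mem_filter, Finset.mem_univ, true_and, Finset.mem_insert,
      Finset.mem_singleton, hf]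
    constructor
    · intro h
      have h' : (σ⁻¹ * ρ) ζₘ = ζₘ := by
        rw [AlgEquiv.mul_apply, h, ← AlgEquiv.mul_apply, inv_mul_cancel, AlgEquiv.one_apply]
      rcases hτ.eq_one_or_eq _ h' with h | h
      · exact .inl (inv_mul_eq_one.1 h).symm
      · exact .inr (inv_mul_eq_iff_eq_mul.1 h)
    · rintro (rfl | rfl)
      · rfl
      · rw [AlgEquiv.mul_apply, hτ.apply_odd]
  rw [this, Finset.card_pair]
  intro h
  exact hτ.ne_one (left_eq_mul.1 h)

variable [IsGalois K L]

/-- Since `σ` and `σ * τ` agree on `ζₘ`, half the trace is the sum of the `j`-th powers of the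
distinct conjugates of `ζₘ`. -/
theorem isIntegral_half_trace [NeZero n] (hₘ : IsPrimitiveRoot ζₘ (oddPart n)) (j : ℕ) :
    IsIntegral ℤ ((1 / 2 : ℚ) • Algebra.trace K L (ζₘ ^ j)) := by
  classical
  rw [← isIntegral_algebraMap_iff (B := L) (algebraMap K L).injective]
  have hsum : algebraMap K L ((1 / 2 : ℚ) • Algebra.trace K L (ζₘ ^ j)) =
      ∑ η ∈ Finset.univ.image (fun σ : Gal(L/K) => σ ζₘ), η ^ j := by
    have := hτ.sum_comp_apply (fun σ => σ ζₘ) (fun _ _ => Iff.rfl) (fun η => η ^ j)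
    rw [map_rat_smul, trace_eq_sum_automorphisms]
    simp only [map_pow]
    rw [this, ← Nat.cast_smul_eq_nsmul ℚ, smul_smul]
    norm_num
  rw [hsum]
  refine IsIntegral.sum _ fun η hη => ?_
  obtain ⟨σ, -, rfl⟩ := Finset.mem_image.1 hη
  have : NeZero (oddPart n) := ⟨(oddPart_pos n).ne'⟩
  refine (isIntegral_of_pow_eq_one (n := oddPart n) ?_).pow j
  rw [← map_pow, hₘ.pow_eq_one, map_one]

/-- The ideal contains all traces, so a prime containing it lies over `2`. It also contains the half
traces of the powers of `ζₘ`, and independence of the power characters `j ↦ η ^ j mod P` excludes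
the primes over `2`. -/
theorem halfTraceIdeal_eq_top [NeZero n] [IsCyclotomicExtension {n} ℚ L] (hn : IsConductor K n)
    (hₘ : IsPrimitiveRoot ζₘ (oddPart n)) : halfTraceIdeal τ = ⊤ := by
  classical
  refine eq_top_of_forall_prime (L := L) _ fun P hP hP0 hle => ?_
  obtain ⟨p, hp, hpP⟩ := exists_prime_natCast_mem hP0
  have hp2 : p = 2 := by
    refine (hn.exists_of_dvd_card_inertia hp hpP (dvd_card_inertia_of_sum_mem hp hpP fun y => ?_)).1
    rw [← algebraMap_intTrace_eq_sum]
    -- The element `y + τ y` is fixed by `τ` and has twice the trace of `y`.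
    refine hle (mem_halfTraceIdeal.2 ⟨y + τ • y, ?_, ?_⟩)
    · rw [smul_add, smul_smul, hτ.mul_self, one_smul, add_comm]
    · rw [map_add, two_mul]
      congr 1
      apply FaithfulSMul.algebraMap_injective (𝓞 K) (𝓞 L)
      rw [algebraMap_intTrace_eq_sum, algebraMap_intTrace_eq_sum]
      simp only [smul_smul]
      exact Fintype.sum_equiv (Equiv.mulRight τ) _ _ fun σ => rfl
  subst hp2
  have hne : NeZero (oddPart n) := ⟨(oddPart_pos n).ne'⟩
  have hodd : ¬ 2 ∣ oddPart n := Nat.not_dvd_ordCompl Nat.prime_two (NeZero.ne n)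
  let Z : 𝓞 L := ⟨ζₘ, isIntegral_of_pow_eq_one hₘ.pow_eq_one⟩
  have hZ : Z ^ oddPart n = 1 := NumberField.RingOfIntegers.ext hₘ.pow_eq_one
  have hτZ : τ • Z = Z := NumberField.RingOfIntegers.ext hτ.apply_odd
  let U : Finset (𝓞 L) := Finset.univ.image fun σ : Gal(L/K) => σ • Z
  have hU {η : 𝓞 L} (hη : η ∈ U) : η ^ oddPart n = 1 := by
    obtain ⟨σ, -, rfl⟩ := Finset.mem_image.1 hη
    rw [← smul_pow', hZ, smul_one]
  have hsum (j : ℕ) : ∑ η ∈ U, η ^ j ∈ P := by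
    have h1 : algebraMap (𝓞 K) (𝓞 L) (Algebra.intTrace (𝓞 K) (𝓞 L) (Z ^ j)) =
        2 * ∑ η ∈ U, η ^ j := by
      rw [algebraMap_intTrace_eq_sum]
      simp only [smul_pow']
      rw [hτ.sum_comp_apply (fun σ => σ • Z) (fun σ ρ => NumberField.RingOfIntegers.ext_iff)
        (fun η => η ^ j), nsmul_eq_mul, Nat.cast_ofNat]
    let z : 𝓞 K := ⟨_, hτ.isIntegral_half_trace hₘ j⟩
    have hz : Algebra.intTrace (𝓞 K) (𝓞 L) (Z ^ j) = 2 * z := by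
      apply NumberField.RingOfIntegers.ext
      change algebraMap (𝓞 K) K _ = 2 * ((1 / 2 : ℚ) • Algebra.trace K L (ζₘ ^ j))
      rw [Algebra.algebraMap_intTrace (L := L)]
      change Algebra.trace K L (ζₘ ^ j) = _
      rw [Algebra.smul_def, ← mul_assoc]
      simp
    have h2 : algebraMap (𝓞 K) (𝓞 L) z = ∑ η ∈ U, η ^ j := by
      refine mul_left_cancel₀ (two_ne_zero (α := 𝓞 L)) ?_
      rw [← h1, hz, map_mul, map_ofNat]
    rw [← h2]
    exact hle (mem_halfTraceIdeal.2 ⟨Z ^ j, by rw [smul_pow', hτZ], hz⟩)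
  let φ (η : U) : Multiplicative ℕ →* 𝓞 L ⧸ P := powersHom _ (Ideal.Quotient.mk P η)
  have hφ (j : Multiplicative ℕ) : ∑ η, φ η j = 0 := by
    have := Ideal.Quotient.eq_zero_iff_mem.2 (hsum j.toAdd)
    rw [map_sum, ← Finset.sum_coe_sort] at this
    simpa [φ] using this
  have hmem : Z ∈ U := Finset.mem_image.2 ⟨1, Finset.mem_univ _, one_smul _ Z⟩
  have hcard := card_fiber_eq_zero_of_sum_eq_zero φ hφ ⟨Z, hmem⟩
  -- The conjugates of `ζₘ` have odd order and stay distinct modulo `P`, so the multiplicity is `1`,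
  -- which cannot vanish.
  have : Unique {η // φ η = φ ⟨Z, hmem⟩} :=
    { default := ⟨⟨Z, hmem⟩, rfl⟩
      uniq := fun ⟨⟨η, hη⟩, h⟩ => by
        refine Subtype.ext (Subtype.ext ?_)
        have h' := (powersHom _).injective h
        exact eq_of_sub_mem_of_pow_eq_one hp hpP hodd hZ (hU hη) (Ideal.Quotient.eq.1 h') }
  rw [Nat.card_unique, Nat.cast_one] at hcard
  exact one_ne_zero hcard

end IsWildInvolution

end Wild

/-! ### Reduction to the basis of the adjusted trace -/

theorem pow_mem_span_int {L : Type*} [Field L] [CharZero L] {k : ℕ} (hk : 0 < k) {ζ : L}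
    (hζ : IsPrimitiveRoot ζ k) (j : ℕ) :
    ζ ^ j ∈ Submodule.span ℤ (Set.range fun i : Fin k.totient => ζ ^ (i : ℕ)) := by
  have h0 : Polynomial.aeval ζ (Polynomial.cyclotomic k ℤ) = 0 := by
    rw [Polynomial.aeval_def, Polynomial.eval₂_eq_eval_map, Polynomial.map_cyclotomic]
    exact hζ.isRoot_cyclotomic hk
  have hmem : ζ ^ j ∈ Subalgebra.toSubmodule (Algebra.adjoin ℤ {ζ}) :=
    pow_mem (Algebra.self_mem_adjoin_singleton ℤ ζ) j
  rw [← Submodule.span_range_natDegree_eq_adjoin (Polynomial.cyclotomic.monic k ℤ) h0,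
    Polynomial.natDegree_cyclotomic] at hmem
  refine Submodule.span_mono ?_ hmem
  intro x hx
  simp only [Finset.coe_image, Finset.coe_range, Set.mem_image, Set.mem_Iio] at hx
  obtain ⟨i, hi, rfl⟩ := hx
  exact ⟨⟨i, hi⟩, rfl⟩

theorem pow_half_eq_neg_one {L : Type*} [Field L] {e : ℕ} (he : e ≠ 0) {ζ : L}
    (h : IsPrimitiveRoot ζ (2 ^ e)) : ζ ^ 2 ^ (e - 1) = -1 := by
  refine IsPrimitiveRoot.eq_neg_one_of_two_right (h.pow (by positivity) ?_)
  rw [← pow_succ, Nat.sub_add_cancel (Nat.pos_of_ne_zero he)]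

/-- Reduction of the exponents of a root of unity of order `2 ^ e` modulo `2 ^ (e - 1)`. -/
theorem pow_eq_or_eq_neg_pow_mod {L : Type*} [Field L] {e : ℕ} (he : e ≠ 0) {ζ : L}
    (h : IsPrimitiveRoot ζ (2 ^ e)) (i : ℕ) :
    ζ ^ i = ζ ^ (i % 2 ^ (e - 1)) ∨ ζ ^ i = - ζ ^ (i % 2 ^ (e - 1)) := by
  have : ζ ^ i = (-1) ^ (i / 2 ^ (e - 1)) * ζ ^ (i % 2 ^ (e - 1)) := by
    conv_lhs => rw [← Nat.div_add_mod i (2 ^ (e - 1)), pow_add, pow_mul, pow_half_eq_neg_one he h]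
  rcases neg_one_pow_eq_or L (i / 2 ^ (e - 1)) with h' | h'
  · exact .inl (by rw [this, h', one_mul])
  · exact .inr (by rw [this, h', neg_one_mul])

/-- With `ζ₂ ^ 2 ^ (e - 1) = -1`, the formula `τ ζ₂ = s ζ₂⁻¹` becomes, up to sign, the reflection `i
↦ 2 ^ (e - 1) - i` of the basis exponents. -/
theorem IsWildInvolution.apply_pow {K L : Type*} [Field K] [Field L] [Algebra K L]
    {n : ℕ} {ζ₂ ζₘ : L} {τ : Gal(L/K)} {s : ℤˣ}
    (hτ : IsWildInvolution n ζ₂ ζₘ τ s) (h₂ : IsPrimitiveRoot ζ₂ (2 ^ twoExp n)) {i : ℕ}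
    (hi : i ≤ 2 ^ (twoExp n - 1)) :
    τ (ζ₂ ^ i) = -(((s ^ i : ℤˣ) : ℤ) : L) * ζ₂ ^ (2 ^ (twoExp n - 1) - i) := by
  have he : twoExp n ≠ 0 := by have := hτ.three_le; omega
  refine mul_right_cancel₀ (pow_ne_zero i (h₂.ne_zero (by positivity))) ?_
  rw [map_pow, ← mul_pow, hτ.apply_two, mul_assoc, ← pow_add, Nat.sub_add_cancel hi,
    pow_half_eq_neg_one he h₂]
  push_cast
  ring

/-! ### Equivariance, integrality and surjectivity of the adjusted trace -/

section AdjustedTrace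

variable {K L : Type*} [Field K] [NumberField K] [Field L] [NumberField L] [Algebra K L]
  {n : ℕ} [NeZero n] [IsCyclotomicExtension {n} ℚ L] {ζ₂ ζₘ : L}
  (h₂ : IsPrimitiveRoot ζ₂ (2 ^ twoExp n)) (hₘ : IsPrimitiveRoot ζₘ (oddPart n))

include h₂ hₘ in
theorem mem_span_int_of_isIntegral (he : twoExp n ≠ 0) {x : L} (hx : IsIntegral ℤ x) :
    x ∈ Submodule.span ℤ (Set.range
      fun k : Fin (2 ^ (twoExp n - 1)) × Fin (oddPart n).totient =>
        ζ₂ ^ (k.1 : ℕ) * ζₘ ^ (k.2 : ℕ)) := by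
  rw [isIntegral_iff_mem_span_pow (isPrimitiveRoot_mul h₂ hₘ)] at hx
  refine (Submodule.span_le.2 ?_) hx
  rintro _ ⟨i, rfl⟩
  have hr : i % 2 ^ (twoExp n - 1) < 2 ^ (twoExp n - 1) := Nat.mod_lt _ (by positivity)
  have key : ζ₂ ^ (i % 2 ^ (twoExp n - 1)) * ζₘ ^ i ∈ Submodule.span ℤ (Set.range
      fun k : Fin (2 ^ (twoExp n - 1)) × Fin (oddPart n).totient =>
        ζ₂ ^ (k.1 : ℕ) * ζₘ ^ (k.2 : ℕ)) := by
    have := Submodule.mem_map_of_mem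
      (f := LinearMap.mulLeft ℤ (ζ₂ ^ (i % 2 ^ (twoExp n - 1))))
      (pow_mem_span_int (oddPart_pos n) hₘ i)
    rw [Submodule.map_span] at this
    refine Submodule.span_mono ?_ this
    rintro _ ⟨_, ⟨j, rfl⟩, rfl⟩
    exact ⟨(⟨_, hr⟩, j), rfl⟩
  change (ζ₂ * ζₘ) ^ i ∈ Submodule.span ℤ _
  rw [mul_pow]
  rcases pow_eq_or_eq_neg_pow_mod he h₂ i with h | h
  · rwa [h]
  · rw [h, neg_mul]
    exact neg_mem key

variable (K)

theorem adjustedTrace_of_isTame (h : IsTame K L) :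
    adjustedTrace h₂ hₘ K = (Algebra.trace K L).restrictScalars ℚ := if_pos h

variable {K}

theorem adjustedTrace_basis (h : ¬ IsTame K L)
    (k : Fin (2 ^ (twoExp n - 1)) × Fin (oddPart n).totient) :
    adjustedTrace h₂ hₘ K (ζ₂ ^ (k.1 : ℕ) * ζₘ ^ (k.2 : ℕ)) =
      (if (k.1 : ℕ) = 0 then 1 / 2 else 1 : ℚ) •
        Algebra.trace K L (ζ₂ ^ (k.1 : ℕ) * ζₘ ^ (k.2 : ℕ)) := by
  rw [adjustedTrace, if_neg h, ← cyclotomicBasis_apply h₂ hₘ, Module.Basis.constr_basis,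
    cyclotomicBasis_apply]
  split_ifs with h0
  · rw [h0, pow_zero, one_mul]
  · rw [one_smul]

/-- The halving condition for arbitrary exponents says that `ζ₂ ^ i = ± 1`, which does not depend on
the basis and is preserved by automorphisms. -/
theorem adjustedTrace_pow_mul_pow (h : ¬ IsTame K L) (he : twoExp n ≠ 0) (i j : ℕ) :
    adjustedTrace h₂ hₘ K (ζ₂ ^ i * ζₘ ^ j) =
      (if 2 ^ (twoExp n - 1) ∣ i then 1 / 2 else 1 : ℚ) •
        Algebra.trace K L (ζ₂ ^ i * ζₘ ^ j) := by
  set N := 2 ^ (twoExp n - 1) with hN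
  have hr : i % N < N := Nat.mod_lt _ (by positivity)
  have key : adjustedTrace h₂ hₘ K (ζ₂ ^ (i % N) * ζₘ ^ j) =
      (if N ∣ i then 1 / 2 else 1 : ℚ) • Algebra.trace K L (ζ₂ ^ (i % N) * ζₘ ^ j) := by
    -- The formula is linear in `ζₘ ^ j`, so it may be checked on the basis powers.
    have hmem := adjoin_le_span (oddPart_pos n) hₘ
      (pow_mem (Algebra.self_mem_adjoin_singleton ℚ ζₘ) j)
    generalize ζₘ ^ j = w at hmem ⊢
    induction hmem using Submodule.span_induction with
    | mem w hw =>
      obtain ⟨j', rfl⟩ := hw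
      have := adjustedTrace_basis h₂ hₘ h (⟨i % N, hr⟩, j')
      simpa only [Nat.dvd_iff_mod_eq_zero] using this
    | zero => simp
    | add x y _ _ hx hy => rw [mul_add, map_add, map_add, hx, hy, smul_add]
    | smul c x _ hx =>
      rw [mul_smul_comm, map_smul, hx, map_rat_smul, smul_comm]
  rcases pow_eq_or_eq_neg_pow_mod he h₂ i with h | h
  · rw [h, key]
  · rw [h, neg_mul, map_neg, map_neg, key, smul_neg]

theorem isEquivariant_adjustedTrace [IsGalois ℚ K] [IsAbelianGalois ℚ L] (h : ¬ IsTame K L)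
    (he : twoExp n ≠ 0) : IsEquivariant (adjustedTrace h₂ hₘ K) := by
  intro σ x
  obtain ⟨a, ha⟩ := exists_apply_eq_pow h₂ (by positivity) σ
  obtain ⟨b, hb⟩ := exists_apply_eq_pow hₘ (oddPart_pos n).ne' σ
  have hprim : IsPrimitiveRoot (ζ₂ ^ a) (2 ^ twoExp n) := ha ▸ h₂.map_of_injective σ.injective
  have hcop : (2 ^ (twoExp n - 1)).Coprime a :=
    (((h₂.pow_iff_coprime (by positivity) a).1 hprim).coprime_dvd_right
      (pow_dvd_pow 2 (Nat.sub_le _ _))).symm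
  have hlin : (adjustedTrace h₂ hₘ K) ∘ₗ σ.toLinearMap =
      (AlgEquiv.restrictNormal σ K).toLinearMap ∘ₗ (adjustedTrace h₂ hₘ K) := by
    refine (cyclotomicBasis h₂ hₘ).ext fun k => ?_
    rw [cyclotomicBasis_apply, LinearMap.comp_apply, LinearMap.comp_apply,
      AlgEquiv.toLinearMap_apply, AlgEquiv.toLinearMap_apply]
    rw [adjustedTrace_pow_mul_pow h₂ hₘ h he, map_rat_smul, ← trace_apply_eq_restrictNormal, map_mul,
      map_pow, map_pow, ha, hb, ← pow_mul, ← pow_mul, adjustedTrace_pow_mul_pow h₂ hₘ h he]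
    simp only [hcop.dvd_mul_left]
  exact DFunLike.congr_fun hlin x

theorem IsWildInvolution.isIntegral_adjustedTrace [IsGalois K L] {τ : Gal(L/K)} {s : ℤˣ}
    (hτ : IsWildInvolution n ζ₂ ζₘ τ s) (h : ¬ IsTame K L) {y : L} (hy : IsIntegral ℤ y) :
    IsIntegral ℤ (adjustedTrace h₂ hₘ K y) := by
  have he : twoExp n ≠ 0 := by have := hτ.three_le; omega
  have hmem := mem_span_int_of_isIntegral h₂ hₘ he hy
  clear hy
  induction hmem using Submodule.span_induction with
  | mem w hw =>
    obtain ⟨k, rfl⟩ := hw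
    rw [adjustedTrace_basis h₂ hₘ h]
    have hne : NeZero (oddPart n) := ⟨(oddPart_pos n).ne'⟩
    split_ifs with h0
    · rw [h0, pow_zero, one_mul]
      exact hτ.isIntegral_half_trace hₘ k.2
    · rw [one_smul]
      exact Algebra.isIntegral_trace (((isIntegral_of_pow_eq_one h₂.pow_eq_one).pow _).mul
        ((isIntegral_of_pow_eq_one hₘ.pow_eq_one).pow _))
  | zero => simpa using isIntegral_zero
  | add x y _ _ hx hy => rw [map_add]; exact hx.add hy
  | smul c x _ hx => rw [map_zsmul]; exact hx.smul c

/-- Every integer of `L` fixed by `τ` is the adjusted trace from `L` to the fixed field of `τ` of an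
integer of `L`. -/
theorem IsWildInvolution.exists_two_mul_adjustedTrace_eq {τ : Gal(L/K)} {s : ℤˣ}
    (hτ : IsWildInvolution n ζ₂ ζₘ τ s) (h : ¬ IsTame K L) {x : L} (hx : IsIntegral ℤ x)
    (hτx : τ x = x) : ∃ y : L, IsIntegral ℤ y ∧
      2 * adjustedTrace h₂ hₘ K y = Algebra.trace K L x := by
  have he3 := hτ.three_le
  have he : twoExp n ≠ 0 := by omega
  set F := adjustedTrace h₂ hₘ K with hF
  set N := 2 ^ (twoExp n - 1) with hN
  -- `M = 2 ^ (e - 2)` is the fixed point of `i ↦ N - i`. It is even because `e ≥ 3`, which makes `s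
  -- ^ M = 1`.
  obtain ⟨M, hM, hM0, hNM⟩ : ∃ M, Even M ∧ 0 < M ∧ N = M + M :=
    ⟨2 ^ (twoExp n - 2), (Nat.even_pow.2 ⟨even_two, by omega⟩), by positivity, by
      rw [hN, ← two_mul, ← pow_succ']; congr 1; omega⟩
  -- `π` keeps the exponents `i < M`, one from each pair `{i, N - i}` with `0 < i < N` and `i ≠ M`,
  -- together with `i = 0`.
  let π : L →ₗ[ℚ] L := (cyclotomicBasis h₂ hₘ).constr ℚ fun k =>
    if (k.1 : ℕ) < M then ζ₂ ^ (k.1 : ℕ) * ζₘ ^ (k.2 : ℕ) else 0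
  have hπ {i j : ℕ} (hi : i < N) (hj : j < (oddPart n).totient) :
      π (ζ₂ ^ i * ζₘ ^ j) = if i < M then ζ₂ ^ i * ζₘ ^ j else 0 := by
    have := cyclotomicBasis_apply h₂ hₘ (⟨i, hi⟩, ⟨j, hj⟩)
    rw [← this, Module.Basis.constr_basis, this]
  have hFb {i j : ℕ} (hi : i < N) (hi0 : i ≠ 0) (hj : j < (oddPart n).totient) :
      F (ζ₂ ^ i * ζₘ ^ j) = Algebra.trace K L (ζ₂ ^ i * ζₘ ^ j) := by
    have := adjustedTrace_basis h₂ hₘ h (⟨i, hi⟩, ⟨j, hj⟩)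
    simpa [hi0] using this
  have hT (w : L) : Algebra.trace K L (τ w) = Algebra.trace K L w :=
    Algebra.trace_eq_of_algEquiv τ w
  -- The claim is `F (π (b + τ b)) = T b`, doubled. For `i = 0` the halving in `F` compensates `b +
  -- τ b = 2 b`; for `i = M` both sides vanish since `τ b = -b`; otherwise `π` keeps exactly one of
  -- `b` and `τ b`, which have equal traces.
  have hbasis (i j : ℕ) (hi : i < N) (hj : j < (oddPart n).totient) :
      2 * F (π (ζ₂ ^ i * ζₘ ^ j + τ (ζ₂ ^ i * ζₘ ^ j))) =
        2 * Algebra.trace K L (ζ₂ ^ i * ζₘ ^ j) := by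
    have hτb (hi0 : i ≠ 0) : ∃ u : ℤˣ, (i = M → u = -1) ∧ τ (ζ₂ ^ i * ζₘ ^ j) =
        (u : ℤ) • (ζ₂ ^ (N - i) * ζₘ ^ j) := by
      refine ⟨-s ^ i, ?_, ?_⟩
      · rintro rfl
        obtain ⟨c, rfl⟩ := hM
        rw [← two_mul, pow_mul, Int.units_sq, one_pow]
      · rw [map_mul, hτ.apply_pow h₂ hi.le, map_pow, hτ.apply_odd, zsmul_eq_mul, mul_assoc,
          Units.val_neg, Int.cast_neg]
    rcases eq_or_ne i 0 with rfl | hi0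
    · have h1 : τ (ζ₂ ^ 0 * ζₘ ^ j) = ζ₂ ^ 0 * ζₘ ^ j := by
        rw [pow_zero, one_mul, map_pow, hτ.apply_odd]
      have h2 := adjustedTrace_basis h₂ hₘ h (⟨0, hi⟩, ⟨j, hj⟩)
      simp only [if_true] at h2
      rw [h1, map_add, hπ hi hj, if_pos hM0, map_add, hF, h2, ← add_smul]
      norm_num
    obtain ⟨u, hu, hτu⟩ := hτb hi0
    rcases lt_trichotomy i M with hlt | heq | hgt
    · rw [map_add, hτu, map_zsmul, hπ hi hj, if_pos hlt, hπ (by omega) hj, if_neg (by omega),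
        smul_zero, add_zero, hFb hi hi0 hj]
    · have hneg : τ (ζ₂ ^ i * ζₘ ^ j) = -(ζ₂ ^ i * ζₘ ^ j) := by
        rw [hτu, hu heq, show N - i = i by omega]
        simp
      have h0 := hT (ζ₂ ^ i * ζₘ ^ j)
      rw [hneg, map_neg, neg_eq_self] at h0
      rw [hneg, add_neg_cancel, h0]
      simp
    · rw [map_add, hπ hi hj, if_neg (by omega), zero_add, hτu, map_zsmul, hπ (by omega) hj,
        if_pos (by omega), map_zsmul, hFb (by omega) (by omega) hj, ← map_zsmul, ← hτu, hT]
  have hlin : (2 : ℚ) • (F ∘ₗ π ∘ₗ (LinearMap.id + (τ.restrictScalars ℚ).toLinearMap)) =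
      (2 : ℚ) • (Algebra.trace K L).restrictScalars ℚ := by
    refine (cyclotomicBasis h₂ hₘ).ext fun k => ?_
    rw [cyclotomicBasis_apply]
    have := hbasis k.1 k.2 k.1.2 k.2.2
    simpa [Algebra.smul_def] using this
  refine ⟨π x, ?_, ?_⟩
  · have hmem := mem_span_int_of_isIntegral h₂ hₘ he hx
    clear hx hτx
    have hne : NeZero (oddPart n) := ⟨(oddPart_pos n).ne'⟩
    induction hmem using Submodule.span_induction with
    | mem w hw =>
      obtain ⟨k, rfl⟩ := hw
      rw [hπ k.1.2 k.2.2]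
      split_ifs
      · exact ((isIntegral_of_pow_eq_one h₂.pow_eq_one).pow _).mul
          ((isIntegral_of_pow_eq_one hₘ.pow_eq_one).pow _)
      · exact isIntegral_zero
    | zero => simpa using isIntegral_zero
    | add x y _ _ hx hy => rw [map_add]; exact hx.add hy
    | smul c x _ hx => rw [map_zsmul]; exact hx.smul c
  · have := DFunLike.congr_fun hlin x
    simp only [LinearMap.smul_apply, LinearMap.comp_apply, LinearMap.add_apply, LinearMap.id_apply,
      AlgEquiv.toLinearMap_apply, AlgEquiv.restrictScalars_apply, hτx,
      LinearMap.restrictScalars_apply, map_add] at this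
    rw [two_mul]
    exact smul_right_injective K (two_ne_zero (α := ℚ)) this

theorem IsWildInvolution.exists_adjustedTrace_eq [IsGalois K L] {τ : Gal(L/K)} {s : ℤˣ}
    (hτ : IsWildInvolution n ζ₂ ζₘ τ s) (hn : IsConductor K n) (h : ¬ IsTame K L) {z : K}
    (hz : IsIntegral ℤ z) : ∃ y : L, IsIntegral ℤ y ∧ adjustedTrace h₂ hₘ K y = z := by
  have hmem : (⟨z, hz⟩ : 𝓞 K) ∈ halfTraceIdeal τ := by
    rw [hτ.halfTraceIdeal_eq_top hn hₘ]
    trivial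
  obtain ⟨x, hτx, hx⟩ := mem_halfTraceIdeal.1 hmem
  obtain ⟨y, hy, hyx⟩ := hτ.exists_two_mul_adjustedTrace_eq h₂ hₘ h x.2
    (congrArg (algebraMap (𝓞 L) L) hτx)
  refine ⟨y, hy, mul_left_cancel₀ (two_ne_zero (α := K)) ?_⟩
  have h1 : Algebra.trace K L x = 2 * z := by
    have := Algebra.algebraMap_intTrace (A := 𝓞 K) (B := 𝓞 L) (K := K) (L := L) x
    rw [hx] at this
    exact this.symm
  rw [hyx]
  exact h1

end AdjustedTrace

end Leopoldt

end

/-! ### The main theorem -/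

theorem theorem6p8 (K L : Type*) [Field K] [NumberField K] [IsAbelianGalois ℚ K]
    (n : ℕ) [NeZero n] (hn : Leopoldt.IsConductor K n)
    [Field L] [NumberField L] [IsCyclotomicExtension {n} ℚ L] [Algebra K L]
    (ζ ζ₂ ζₘ : L) (hζ : IsPrimitiveRoot ζ n)
    (h₂ : IsPrimitiveRoot ζ₂ (2 ^ Leopoldt.twoExp n))
    (hₘ : IsPrimitiveRoot ζₘ (Leopoldt.oddPart n))
    (α : K)
    (hα : α = Leopoldt.adjustedTrace h₂ hₘ K (∑ d ∈ Leopoldt.divisorSet n, ζ ^ (n / d))) :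
    {x : K | IsIntegral ℤ x} =
        {x : K | ∃ γ ∈ Leopoldt.associatedOrder ℚ K, Leopoldt.groupAlgebraAction ℚ K γ α = x} ∧
      Module.Free (Leopoldt.associatedOrder ℚ K) (𝓞 K) ∧
      Module.finrank (Leopoldt.associatedOrder ℚ K) (𝓞 K) = 1 := by
  have : IsAbelianGalois ℚ L := IsCyclotomicExtension.isAbelianGalois {n} ℚ L
  have : IsGalois K L := IsGalois.tower_top_of_isGalois ℚ K L
  have hβ : IsIntegral ℤ (∑ d ∈ Leopoldt.divisorSet n, ζ ^ (n / d)) :=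
    IsIntegral.sum _ fun d _ => (Leopoldt.isIntegral_of_pow_eq_one hζ.pow_eq_one).pow _
  have hgen := fun (y : L) (hy : IsIntegral ℤ y) =>
    Leopoldt.exists_groupAlgebraAction_sum_eq hζ hy
  have heq : {x : K | IsIntegral ℤ x} = {x : K | ∃ γ ∈ Leopoldt.associatedOrder ℚ K,
      Leopoldt.groupAlgebraAction ℚ K γ α = x} := by
    subst hα
    by_cases h : Leopoldt.IsTame K L
    · rw [Leopoldt.adjustedTrace_of_isTame K h₂ hₘ h]
      exact (Leopoldt.isEquivariant_trace K L).setOf_isIntegral_eq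
        (fun y hy => Algebra.isIntegral_trace hy) (fun z hz => h.exists_trace_eq hz) hβ hgen
    · obtain ⟨τ, s, hτ⟩ := hn.exists_isWildInvolution h₂ hₘ h
      have he : Leopoldt.twoExp n ≠ 0 := by have := hτ.three_le; omega
      exact (Leopoldt.isEquivariant_adjustedTrace h₂ hₘ h he).setOf_isIntegral_eq
        (fun y hy => hτ.isIntegral_adjustedTrace h₂ hₘ h hy)
        (fun z hz => hτ.exists_adjustedTrace_eq h₂ hₘ hn h hz) hβ hgen
  exact ⟨heq, Leopoldt.free_and_finrank_eq_one heq⟩
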